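/- Let $d,T\ge 1$, $D\ge 1$, and let $\mathcal K=\{x\in\mathbb R^d:\|x\|\le D\}$ (Euclidean norm). Put $\mathcal K_\delta=\{x:\frac1{1-\delta}x\in\mathcal K\}$, $\mathcal K'_\delta=\{(x,1):x\in\mathcal K_\delta\}$ and $con(\mathcal K)=\{\mathbf 0\}\cup\{(x,b):x/b\in\mathcal K,\ b>0\}\subseteq\mathbb R^{d+1}$. Let $\mathcal R$ be a $\nu$-normal barrier on $con(\mathcal K)$: $\nu\ge1$; $\mathcal R$ is convex and three times continuously differentiable on the interior of $con(\mathcal K)$ and tends to infinity at every boundary point; and for all interior $x$, all $h\in\mathbb R^{d+1}$ and all $t>0$, with $\|h\|_x=\sqrt{h^\top\nabla^2\mathcal R(x)h}$, one has $\nabla^3\mathcal R(x)[h,h,h]\le 2\|h\|_x^3$, $|\nabla\mathcal R(x)^\top h|\le\sqrt\nu\,\|h\|_x$ and $\mathcal R(tx)=\mathcal R(x)-\nu\ln t$. Let $\epsilon\ge 0$ and let $f_1,\dots,f_T$ be losses with $f_t(x)=\theta_t^\top x+\sigma_t(x)$, $|\sigma_t(x)|\le\epsilon$ and $|f_t(x)|\le1$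 for all $x\in\mathcal K$, where the vectors $\theta_t\in\mathbb R^d$, $\|\theta_t\|\le G$, are fixed before the game, while the perturbation $\sigma_t$ may depend on the history up to and including the play of round $t$. Put $\delta=1/T^2$ if $\epsilon=0$ and $\delta=\sqrt\epsilon$ otherwise, assume $\delta<1$, and put $\eta=\frac{\sqrt{\nu\ln(1/\delta)}}{2d\sqrt T}$. SCRiBLe with lifting starts from $x'_1=\arg\min_{x'\in\mathcal K'_\delta}\mathcal R(x')$. In round $t=1,\dots,T$ it sets $\mathbf A_t=[\nabla^2\mathcal R(x'_t)]^{-1/2}$, draws $\mu_t$, given the past, uniformly from the unit vectors of $\mathbb R^{d+1}$ orthogonal to $\mathbf A_te_{d+1}$, plays $y_t$ where $(y_t,1)=x'_t+\mathbf A_t\mu_t$, observes only $f_t(y_t)$, sets $g_t=d\,f_t(y_t)\mathbf A_t^{-1}\mu_t$, and updates $x'_{t+1}=\arg\min_{x'\in\mathcal K'_\delta}\bigl(\eta\sum_{\tau=1}^t g_\tau^\top x'+\mathcal R(x')\bigr)$. Then $$\mathbb E\Bigl[\sum_{t=1}^Tf_t(y_t)-\inf_{x\in\mathcal K}\sum_{t=1}^Tf_t(x)\Bigr]\le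 4d\sqrt{\nu T\ln\tfrac1\delta}+2dT(\nu+2\sqrt\nu)\tfrac{1-\delta}{\delta}\epsilon+\delta GDT+2T\epsilon .$$ Moreover, the right-hand side is at most $C\bigl(\sqrt{\ln(1/\delta)}\,d\sqrt T+\sqrt\epsilon\,dT+\epsilon dT\bigr)$ with a constant $C$ that depends only on $\nu$, $G$ and $D$; that is, it is $\tilde O(d\sqrt T+\sqrt\epsilon\,dT+\epsilon dT)$. -/

import Mathlib

open MeasureTheory ProbabilityTheory Filter Topology
open scoped Matrix

noncomputable section

namespace BanditLifting

/-- Euclidean space `ℝⁿ` with the `2`-norm. -/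
abbrev Vec (n : ℕ) : Type := EuclideanSpace ℝ (Fin n)

/-- The point `(x, b)` of `ℝ^(d+1)`, for `x ∈ ℝ^d` and `b ∈ ℝ`. -/
def pair {d : ℕ} (x : Vec d) (b : ℝ) : Vec (d + 1) :=
  WithLp.toLp 2 (Fin.snoc (α := fun _ => ℝ) (fun i => x i) b)

/-- The first `d` coordinates of a point of `ℝ^(d+1)`. -/
def firstCoords {d : ℕ} (z : Vec (d + 1)) : Vec d :=
  WithLp.toLp 2 (fun i => z i.castSucc)

/-- The product of a matrix and a vector of Euclidean space. -/
def mulVecE {n : ℕ} (A : Matrix (Fin n) (Fin n) ℝ) (z : Vec n) : Vec n :=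
  WithLp.toLp 2 (A *ᵥ z.ofLp)

/-! ### Normal barriers -/

/-- The Hessian matrix `∇²R(x)`. -/
def hessian {n : ℕ} (R : Vec n → ℝ) (x : Vec n) : Matrix (Fin n) (Fin n) ℝ :=
  Matrix.of fun i j =>
    iteratedFDeriv ℝ 2 R x ![EuclideanSpace.single i 1, EuclideanSpace.single j 1]

/-- The local norm `‖h‖_x = √(hᵀ ∇²R(x) h)`. -/
def localNorm {n : ℕ} (R : Vec n → ℝ) (x h : Vec n) : ℝ :=
  √(inner ℝ h (mulVecE (hessian R x) h))

/-- `Ψ` is a closed and proper convex cone: closed, convex, stable under nonnegative scaling,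
pointed (it contains no line) and with nonempty interior. -/
structure IsClosedProperCone {n : ℕ} (Ψ : Set (Vec n)) : Prop where
  isClosed : IsClosed Ψ
  convex : Convex ℝ Ψ
  smul_mem : ∀ x ∈ Ψ, ∀ c : ℝ, 0 ≤ c → c • x ∈ Ψ
  pointed : ∀ x ∈ Ψ, -x ∈ Ψ → x = 0
  nonempty_interior : (interior Ψ).Nonempty

/-- `R` is a `ν`-logarithmically homogeneous self-concordant barrier (a `ν`-normal barrier) on the
closed and proper convex cone `Ψ`. Only the values of `R` on the interior of `Ψ` matter. -/
structure IsNormalBarrier {n : ℕ} (Ψ : Set (Vec n)) (ν : ℝ) (R : Vec n → ℝ) : Prop where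
  cone : IsClosedProperCone Ψ
  one_le : 1 ≤ ν
  contDiffOn : ContDiffOn ℝ 3 R (interior Ψ)
  convexOn : ConvexOn ℝ (interior Ψ) R
  tendsto_atTop : ∀ z ∈ frontier Ψ, Tendsto R (𝓝[interior Ψ] z) atTop
  third_le : ∀ x ∈ interior Ψ, ∀ h : Vec n,
    iteratedFDeriv ℝ 3 R x ![h, h, h] ≤ 2 * localNorm R x h ^ 3
  grad_le : ∀ x ∈ interior Ψ, ∀ h : Vec n, |fderiv ℝ R x h| ≤ √ν * localNorm R x h
  log_homogeneous : ∀ x ∈ interior Ψ, ∀ t : ℝ, 0 < t → R (t • x) = R x - ν * Real.log t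

/-! ### The decision sets -/

/-- `con(K) = {0} ∪ {(x, b) : x / b ∈ K, b > 0}`. -/
def con {d : ℕ} (K : Set (Vec d)) : Set (Vec (d + 1)) :=
  {0} ∪ {z | ∃ (x : Vec d) (b : ℝ), 0 < b ∧ (1 / b) • x ∈ K ∧ z = pair x b}

/-- `K_δ = {x : x / (1 - δ) ∈ K}`. -/
def shrink {d : ℕ} (δ : ℝ) (K : Set (Vec d)) : Set (Vec d) :=
  {x | (1 / (1 - δ)) • x ∈ K}

/-- The lifted set `S' = {(x, 1) : x ∈ S}`. -/
def lift {d : ℕ} (S : Set (Vec d)) : Set (Vec (d + 1)) :=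
  {z | ∃ x ∈ S, z = pair x 1}

/-! ### Losses and regret -/

/-- `f` is `ε`-approximately linear on `K` with linear part `θ`:
the perturbation `σ(x) = f(x) - θᵀx` satisfies `|σ(x)| ≤ ε` on `K`. -/
def IsApproxLinear {d : ℕ} (K : Set (Vec d)) (ε : ℝ) (θ : Vec d) (f : Vec d → ℝ) : Prop :=
  ∀ x ∈ K, |f x - inner ℝ θ x| ≤ ε

/-- The regret of the plays `y 0, …, y (T-1)` against the losses `f 0, …, f (T-1)`. -/
def regret {d : ℕ} (K : Set (Vec d)) (T : ℕ) (f : ℕ → Vec d → ℝ) (y : ℕ → Vec d) : ℝ :=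
  ∑ t ∈ Finset.range T, f t (y t) - ⨅ x : K, ∑ t ∈ Finset.range T, f t x

/-! ### Uniform sampling -/

/-- The uniform probability measure on the unit sphere of a Euclidean space `E`: the normalized
surface measure. -/
def uniformSphere (E : Type*) [NormedAddCommGroup E] [InnerProductSpace ℝ E]
    [FiniteDimensional ℝ E] [MeasurableSpace E] [BorelSpace E] :
    Measure (Metric.sphere (0 : E) 1) :=
  ((volume : Measure E).toSphere Set.univ)⁻¹ • (volume : Measure E).toSphere

/-- The uniform probability measure on `S ∩ v^⊥`, where `S` is the unit sphere of `ℝⁿ`,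
as a measure on `ℝⁿ`. -/
def uniformPerp {n : ℕ} (v : Vec n) : Measure (Vec n) :=
  (uniformSphere ((ℝ ∙ v)ᗮ : Submodule ℝ (Vec n))).map fun s => (s.1 : Vec n)

/-! ### SCRiBLe with lifting -/

/-- `A = [∇²R(x')]^(-1/2)`, through the spectral calculus of symmetric matrices. -/
def scaling {n : ℕ} (R : Vec n → ℝ) (x' : Vec n) : Matrix (Fin n) (Fin n) ℝ :=
  cfc (fun s : ℝ => s ^ (-(1 / 2) : ℝ)) (hessian R x')

/-- The point `y` that is played, where `(y, 1) = x' + A u`. -/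
def play {d : ℕ} (R : Vec (d + 1) → ℝ) (x' u : Vec (d + 1)) : Vec d :=
  firstCoords (x' + mulVecE (scaling R x') u)

/-- The estimator `g = d f(y) A⁻¹ u`. -/
def estimator {d : ℕ} (R : Vec (d + 1) → ℝ) (f : Vec d → ℝ) (x' u : Vec (d + 1)) :
    Vec (d + 1) :=
  ((d : ℝ) * f (play R x' u)) • mulVecE (scaling R x')⁻¹ u

/-- `(x', u)` is a run of SCRiBLe with lifting for `T` rounds, with parameters `η`, `δ` and the
barrier `R`, against the (possibly random) losses `f`. Rounds are numbered from `0`.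
The `σ`-algebra `ℱ t` is the information available before the draw of round `t`. -/
structure IsRun {Ω : Type*} [mΩ : MeasurableSpace Ω] (P : Measure Ω) {d : ℕ} (T : ℕ)
    (K : Set (Vec d)) (η δ : ℝ) (R : Vec (d + 1) → ℝ) (f : ℕ → Ω → Vec d → ℝ)
    (ℱ : Filtration ℕ mΩ) (x' u : ℕ → Ω → Vec (d + 1)) : Prop where
  /-- `x'_t` is known before the draw of round `t`. -/
  measurable_x : ∀ t < T, Measurable[ℱ t] (x' t)
  /-- The direction drawn in round `t` is known after round `t`. -/
  measurable_u : ∀ t < T, Measurable[ℱ (t + 1)] (u t)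
  /-- The loss observed in round `t` is known after round `t`. -/
  measurable_loss : ∀ t < T,
    Measurable[ℱ (t + 1)] (fun ω => f t ω (play R (x' t ω) (u t ω)))
  /-- `x'_t` minimizes `η ∑_{τ < t} g_τᵀ z + R(z)` over the lifted set `K'_δ`. -/
  mem : ∀ t < T, ∀ ω, x' t ω ∈ lift (shrink δ K)
  isMinOn : ∀ t < T, ∀ ω,
    IsMinOn (fun z => η * ∑ τ ∈ Finset.range t,
      inner ℝ (estimator R (f τ ω) (x' τ ω) (u τ ω)) z + R z) (lift (shrink δ K)) (x' t ω)
  /-- Given the past, `u_t` is uniform on the unit sphere intersected with `(A_t e_{d+1})^⊥`. -/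
  uniform : ∀ t < T, ∀ B : Set (Vec (d + 1)), MeasurableSet B →
    P[(u t ⁻¹' B).indicator (fun _ => (1 : ℝ)) | ℱ t] =ᵐ[P] fun ω =>
      (uniformPerp (mulVecE (scaling R (x' t ω))
        (EuclideanSpace.single (Fin.last d) 1))).real B

/-! ### Parameters and bound -/

/-- `δ = 1 / T²` if `ε = 0`, and `δ = √ε` otherwise. -/
def deltaParam (T : ℕ) (ε : ℝ) : ℝ := if ε = 0 then 1 / (T : ℝ) ^ 2 else √ε

/-- `η = √(ν ln(1/δ)) / (2 d √T)`. -/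
def etaParam (d T : ℕ) (ν δ : ℝ) : ℝ := √(ν * Real.log (1 / δ)) / (2 * d * √T)

/-- `4d√(νT ln(1/δ)) + 2dT(ν + 2√ν)((1-δ)/δ)ε + δGDT + 2Tε`. -/
def regretBound (d T : ℕ) (ν G D ε δ : ℝ) : ℝ :=
  4 * d * √(ν * T * Real.log (1 / δ)) + 2 * d * T * (ν + 2 * √ν) * ((1 - δ) / δ) * ε
    + δ * G * D * T + 2 * T * ε

end BanditLifting

end

/-! Since the vectors `θ t` are fixed in advance, the comparator can be taken deterministic: the
minimizer `w` of their sum over the ball of radius `(1 - δ) D`. Replacing losses by their linear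
parts costs `2Tε` and shrinking the ball costs `δGDT` (`regret_le_linear`), so the linear regret
against `w` remains.

A play is `x + A u` with `u` uniform on the unit sphere of a `d`-dimensional hyperplane, whose
second moment is `1/d` times the projection. For two points of the lifted set, `A⁻¹` applied to
their difference lies in that hyperplane, so the linear part of the loss enters the estimator
without bias (`integral_estimate_eq_zero`). The perturbation may depend on the draw; it is bounded
draw by draw, by `dε` times the local norm of `x - (w, 1)` (`inner_sub_le_estimator`).

Three facts about the barrier finish the proof, all obtained by integrating self-concordance along
lines and using logarithmic homogeneity. The objective grows by at least `a - log (1 + a)` at local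
distance `a` from its minimizer, which gives the regret of the regularized leader (`ftrl_le`). The
barrier oscillates by at most `5/3 ν log (1/δ)` on the lifted set (`sub_le_of_mem_lift`), and the
local diameter of that set is of order `ν/δ` (`localNorm_sub_le_of_mem_lift`). These need `δ ≤ 1/2`
and `η d ≤ 1/4`; otherwise the claimed bound is at least `2T`, which the regret never exceeds almost
surely. -/

noncomputable section

namespace BanditLifting

/-! ### Second derivatives -/

/-- The second derivative `D²R(x)[h, k]`. -/
def secondDeriv {n : ℕ} (R : Vec n → ℝ) (x h k : Vec n) : ℝ := fderiv ℝ (fderiv ℝ R) x h k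

lemma hessian_apply {n : ℕ} (R : Vec n → ℝ) (x : Vec n) (i j : Fin n) :
    hessian R x i j =
      secondDeriv R x (EuclideanSpace.single i 1) (EuclideanSpace.single j 1) := by
  simp [hessian, secondDeriv, iteratedFDeriv_two_apply]

/-- Links the Hessian matrix of the definitions to the bilinear form in which the calculus is done.
-/
lemma inner_mulVecE_hessian {n : ℕ} (R : Vec n → ℝ) (x h k : Vec n) :
    inner ℝ h (mulVecE (hessian R x) k) = secondDeriv R x h k := by
  have e : ∀ w : Vec n, w = ∑ i, w i • EuclideanSpace.single i (1 : ℝ) := by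
    intro w
    simpa using ((EuclideanSpace.basisFun (Fin n) ℝ).sum_repr w).symm
  have key : secondDeriv R x h k = ∑ i, ∑ j, h i * k j *
      secondDeriv R x (EuclideanSpace.single i 1) (EuclideanSpace.single j 1) := by
    conv_lhs => rw [e h, e k]
    simp only [secondDeriv, map_sum, map_smul, sum_apply,
      smul_apply, smul_eq_mul, Finset.mul_sum]
    rw [Finset.sum_comm]
    exact Finset.sum_congr rfl fun i _ => Finset.sum_congr rfl fun j _ => by ring
  rw [key]
  simp only [mulVecE, PiLp.inner_apply, Matrix.mulVec, dotProduct, hessian_apply, RCLike.inner_apply,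
    conj_trivial, Finset.sum_mul]
  exact Finset.sum_congr rfl fun i _ => Finset.sum_congr rfl fun j _ => by ring

lemma secondDeriv_smul {n : ℕ} (R : Vec n → ℝ) (x h : Vec n) (s : ℝ) :
    secondDeriv R x (s • h) (s • h) = s ^ 2 * secondDeriv R x h h := by
  simp [secondDeriv]; ring

lemma localNorm_eq {n : ℕ} (R : Vec n → ℝ) (x h : Vec n) :
    localNorm R x h = √(secondDeriv R x h h) := by
  rw [localNorm, inner_mulVecE_hessian]

lemma localNorm_nonneg {n : ℕ} (R : Vec n → ℝ) (x h : Vec n) : 0 ≤ localNorm R x h :=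
  Real.sqrt_nonneg _

lemma localNorm_smul {n : ℕ} (R : Vec n → ℝ) (x h : Vec n) (s : ℝ) :
    localNorm R x (s • h) = |s| * localNorm R x h := by
  rw [localNorm_eq, localNorm_eq, secondDeriv_smul, Real.sqrt_mul (sq_nonneg s),
    Real.sqrt_sq_eq_abs]

lemma hasDerivAt_line {n : ℕ} (x h : Vec n) (s : ℝ) :
    HasDerivAt (fun s : ℝ => x + s • h) h s := by
  simpa using ((hasDerivAt_id s).smul_const h).const_add x

/-! ### Derivatives of the barrier along lines -/

namespace IsNormalBarrier

variable {n : ℕ} {Ψ : Set (Vec n)} {ν : ℝ} {R : Vec n → ℝ}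

lemma contDiffAt (hR : IsNormalBarrier Ψ ν R) {x : Vec n} (hx : x ∈ interior Ψ) :
    ContDiffAt ℝ 3 R x :=
  hR.contDiffOn.contDiffAt (isOpen_interior.mem_nhds hx)

lemma contDiffAt_fderiv (hR : IsNormalBarrier Ψ ν R) {x : Vec n} (hx : x ∈ interior Ψ) :
    ContDiffAt ℝ 2 (fderiv ℝ R) x :=
  (hR.contDiffAt hx).fderiv_right (by norm_num)

lemma contDiffAt_fderiv_fderiv (hR : IsNormalBarrier Ψ ν R) {x : Vec n} (hx : x ∈ interior Ψ) :
    ContDiffAt ℝ 1 (fderiv ℝ (fderiv ℝ R)) x :=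
  (hR.contDiffAt_fderiv hx).fderiv_right (by norm_num)

lemma hasFDerivAt (hR : IsNormalBarrier Ψ ν R) {x : Vec n} (hx : x ∈ interior Ψ) :
    HasFDerivAt R (fderiv ℝ R x) x :=
  ((hR.contDiffAt hx).differentiableAt (by norm_num)).hasFDerivAt

lemma hasDerivAt_comp_line (hR : IsNormalBarrier Ψ ν R) {x h : Vec n} {s : ℝ}
    (hx : x + s • h ∈ interior Ψ) :
    HasDerivAt (fun s : ℝ => R (x + s • h)) (fderiv ℝ R (x + s • h) h) s :=
  (hR.hasFDerivAt hx).comp_hasDerivAt s (hasDerivAt_line x h s)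

lemma hasDerivAt_fderiv_line (hR : IsNormalBarrier Ψ ν R) {x h k : Vec n} {s : ℝ}
    (hx : x + s • h ∈ interior Ψ) :
    HasDerivAt (fun s : ℝ => fderiv ℝ R (x + s • h) k) (secondDeriv R (x + s • h) h k) s := by
  have h1 : HasFDerivAt (fderiv ℝ R) (fderiv ℝ (fderiv ℝ R) (x + s • h)) (x + s • h) :=
    ((hR.contDiffAt_fderiv hx).differentiableAt (by norm_num)).hasFDerivAt
  have h2 := (h1.clm_apply (hasFDerivAt_const k _)).comp_hasDerivAt s (hasDerivAt_line x h s)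
  refine h2.congr_deriv ?_
  simp [secondDeriv]

lemma hasDerivAt_secondDeriv_line (hR : IsNormalBarrier Ψ ν R) {x h : Vec n} {s : ℝ}
    (hx : x + s • h ∈ interior Ψ) :
    HasDerivAt (fun s : ℝ => secondDeriv R (x + s • h) h h)
      (iteratedFDeriv ℝ 3 R (x + s • h) ![h, h, h]) s := by
  have hd : DifferentiableAt ℝ (fderiv ℝ (fderiv ℝ R)) (x + s • h) :=
    (hR.contDiffAt_fderiv_fderiv hx).differentiableAt (by norm_num)
  have hg : DifferentiableAt ℝ (fun y => fderiv ℝ (fderiv ℝ R) y h h) (x + s • h) :=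
    (hd.clm_apply (differentiableAt_const h)).clm_apply (differentiableAt_const h)
  have hit : DifferentiableAt ℝ (iteratedFDeriv ℝ 2 R) (x + s • h) :=
    ((hR.contDiffAt hx).iteratedFDeriv_right (m := 1) (i := 2)
      (by norm_num)).differentiableAt (by norm_num)
  have h4 : iteratedFDeriv ℝ 3 R (x + s • h) ![h, h, h] =
      fderiv ℝ (fun y => fderiv ℝ (fderiv ℝ R) y h h) (x + s • h) h := by
    rw [hit.iteratedFDeriv_succ_apply_left']
    have : (fun y => iteratedFDeriv ℝ 2 R y (Fin.tail ![h, h, h])) =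
        fun y => fderiv ℝ (fderiv ℝ R) y h h := by
      funext y
      rw [iteratedFDeriv_two_apply]
      rfl
    rw [this]
    rfl
  rw [h4]
  exact hg.hasFDerivAt.comp_hasDerivAt s (hasDerivAt_line x h s)

lemma add_smul_mem_interior (hR : IsNormalBarrier Ψ ν R) {x h : Vec n} {r s : ℝ}
    (hx : x ∈ interior Ψ) (hs : x + s • h ∈ interior Ψ) (h0 : 0 ≤ r) (hr : r ≤ s) :
    x + r • h ∈ interior Ψ := by
  rcases h0.eq_or_lt with rfl | h0
  · simpa using hx
  have hs0 : 0 < s := h0.trans_le hr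
  have := hR.cone.convex.interior.add_smul_mem hx hs (t := r / s)
    ⟨by positivity, (div_le_one hs0).2 hr⟩
  rwa [smul_smul, div_mul_cancel₀ _ hs0.ne'] at this

lemma line_zero_mem {x h : Vec n} (hx : x ∈ interior Ψ) : x + (0 : ℝ) • h ∈ interior Ψ := by
  simpa using hx

lemma fderiv_le_sub (hR : IsNormalBarrier Ψ ν R) {x y : Vec n}
    (hx : x ∈ interior Ψ) (hy : y ∈ interior Ψ) : fderiv ℝ R x (y - x) ≤ R y - R x := by
  have hmem : ∀ s ∈ Set.Icc (0 : ℝ) 1, x + s • (y - x) ∈ interior Ψ := fun s hs =>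
    hR.add_smul_mem_interior hx (by simpa using hy) hs.1 hs.2
  have hc : ConvexOn ℝ (Set.Icc (0 : ℝ) 1) (fun s : ℝ => R (x + s • (y - x))) := by
    refine ⟨convex_Icc 0 1, fun a ha b hb p q hp hq hpq => ?_⟩
    have := hR.convexOn.2 (hmem a ha) (hmem b hb) hp hq hpq
    convert this using 2
    obtain rfl : p = 1 - q := by linarith
    module
  have hd := hR.hasDerivAt_comp_line (s := 0) (h := y - x) (line_zero_mem hx)
  have := hc.le_slope_of_hasDerivAt (by simp) (by simp) one_pos hd
  simpa [slope_def_field] using this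

/-- Adding the gradient inequalities at `x` and at `x + s • h` makes the difference quotients of the
directional derivative nonnegative. -/
lemma secondDeriv_nonneg (hR : IsNormalBarrier Ψ ν R) {x : Vec n} (hx : x ∈ interior Ψ)
    (h : Vec n) : 0 ≤ secondDeriv R x h h := by
  have hd := hR.hasDerivAt_fderiv_line (s := 0) (h := h) (k := h) (line_zero_mem hx)
  have hcont : ContinuousAt (fun s : ℝ => x + s • h) 0 := by fun_prop
  have hev : ∀ᶠ s in 𝓝 (0 : ℝ), x + s • h ∈ interior Ψ :=
    hcont (isOpen_interior.mem_nhds (by simpa using hx))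
  have ht := (hasDerivAt_iff_tendsto_slope_zero.1 hd).mono_left
    (nhdsWithin_mono 0 (fun s (hs : s ∈ Set.Ioi (0 : ℝ)) => ne_of_gt hs))
  simp only [zero_smul, add_zero, zero_add] at ht
  refine ge_of_tendsto ht ?_
  filter_upwards [hev.filter_mono nhdsWithin_le_nhds, self_mem_nhdsWithin] with s hs hs0
  have h1 := hR.fderiv_le_sub hx hs
  have h2 := hR.fderiv_le_sub hs hx
  have e : x - (x + s • h) = -(s • h) := by abel
  rw [add_sub_cancel_left, map_smul, smul_eq_mul] at h1
  rw [e, map_neg, map_smul, smul_eq_mul] at h2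
  have h3 : 0 < s := hs0
  have : 0 ≤ fderiv ℝ R (x + s • h) h - fderiv ℝ R x h := by
    by_contra! hneg
    nlinarith
  simp only [smul_eq_mul]
  positivity

lemma localNorm_sq (hR : IsNormalBarrier Ψ ν R) {x : Vec n} (hx : x ∈ interior Ψ) (h : Vec n) :
    localNorm R x h ^ 2 = secondDeriv R x h h := by
  rw [localNorm_eq, Real.sq_sqrt (hR.secondDeriv_nonneg hx h)]

/-- The cubic form is odd in `h` and the local norm is even, so the one-sided bound at `-h` gives
the lower bound. -/
lemma abs_third_le (hR : IsNormalBarrier Ψ ν R) {x : Vec n} (hx : x ∈ interior Ψ) (h : Vec n) :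
    |iteratedFDeriv ℝ 3 R x ![h, h, h]| ≤ 2 * localNorm R x h ^ 3 := by
  refine abs_le.2 ⟨?_, hR.third_le x hx h⟩
  have h1 := hR.third_le x hx (-h)
  have e : (![-h, -h, -h] : Fin 3 → Vec n) = fun i => (-1 : ℝ) • (![h, h, h] : Fin 3 → Vec n) i := by
    funext i; fin_cases i <;> simp
  have h2 : localNorm R x (-h) = localNorm R x h := by
    have := localNorm_smul R x h (-1)
    simpa using this
  rw [e, ContinuousMultilinearMap.map_smul_univ, h2] at h1
  simp at h1
  linarith

/-! ### Leaving the cone along a line -/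

/-- The barrier is unbounded on any half-open segment that leaves the interior. -/
lemma mem_interior_of_le (hR : IsNormalBarrier Ψ ν R) {x h : Vec n} {s M : ℝ}
    (hx : x ∈ interior Ψ) (hs : 0 ≤ s)
    (hM : ∀ r, 0 ≤ r → r ≤ s → x + r • h ∈ interior Ψ → R (x + r • h) ≤ M) :
    x + s • h ∈ interior Ψ := by
  by_contra hns
  -- The infimum of `S` is the first exit time. It is positive, and the exit point lies on the
  -- frontier, where the barrier blows up and contradicts the bound `M`.
  set S : Set ℝ := {r | r ∈ Set.Icc 0 s ∧ x + r • h ∉ interior Ψ} with hS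
  have hcont : Continuous (fun r : ℝ => x + r • h) := by fun_prop
  have hclosed : IsClosed S :=
    isClosed_Icc.inter ((isOpen_interior.preimage hcont).isClosed_compl)
  have hne : S.Nonempty := ⟨s, ⟨hs, le_rfl⟩, hns⟩
  have hbdd : BddBelow S := ⟨0, fun r hr => hr.1.1⟩
  have hmem : sInf S ∈ S := hclosed.csInf_mem hne hbdd
  set r0 := sInf S with hr0
  have hlt : ∀ r, 0 ≤ r → r < r0 → x + r • h ∈ interior Ψ := by
    intro r h0 hr
    by_contra hcon
    exact absurd (csInf_le hbdd (show r ∈ S from ⟨⟨h0, hr.le.trans hmem.1.2⟩, hcon⟩)) (not_le.2 hr)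
  have hpos : 0 < r0 := by
    rcases hmem.1.1.eq_or_lt with h0 | h0
    · exact absurd (by rw [← h0]; simpa using hx) hmem.2
    · exact h0
  have hev : ∀ᶠ r in 𝓝[<] r0, x + r • h ∈ interior Ψ ∧ 0 ≤ r ∧ r ≤ s := by
    filter_upwards [Ioo_mem_nhdsLT hpos] with r hr
    exact ⟨hlt r hr.1.le hr.2, hr.1.le, hr.2.le.trans hmem.1.2⟩
  have ht : Tendsto (fun r : ℝ => x + r • h) (𝓝[<] r0) (𝓝[interior Ψ] (x + r0 • h)) :=
    tendsto_nhdsWithin_iff.2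
      ⟨(hcont.tendsto r0).mono_left nhdsWithin_le_nhds, hev.mono fun r hr => hr.1⟩
  have hfr : x + r0 • h ∈ frontier Ψ := by
    refine ⟨?_, hmem.2⟩
    refine closure_mono interior_subset ?_
    exact mem_closure_of_tendsto (ht.mono_right nhdsWithin_le_nhds) (hev.mono fun r hr => hr.1)
  have hbig := ((hR.tendsto_atTop _ hfr).comp ht).eventually_gt_atTop M
  obtain ⟨r, hr1, hr2⟩ := (hbig.and hev).exists
  exact absurd (hM r hr2.2.1 hr2.2.2 hr2.1) (not_le.2 hr1)

/-- A direction along which the barrier stays inside the cone belongs to the cone. -/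
lemma mem_of_forall_add_smul_mem (hR : IsNormalBarrier Ψ ν R) {x h : Vec n}
    (hall : ∀ s : ℝ, 0 ≤ s → x + s • h ∈ Ψ) : h ∈ Ψ := by
  -- Rescaling by `1 / s` sends the base point to `0`, and a closed cone keeps the limit.
  have h1 : ∀ᶠ s : ℝ in atTop, s⁻¹ • x + h ∈ Ψ := by
    filter_upwards [eventually_gt_atTop 0] with s hs
    have := hR.cone.smul_mem _ (hall s hs.le) s⁻¹ (by positivity)
    rwa [smul_add, smul_smul, inv_mul_cancel₀ hs.ne', one_smul] at this
  have h2 : Tendsto (fun s : ℝ => s⁻¹ • x + h) atTop (𝓝 ((0 : ℝ) • x + h)) :=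
    (tendsto_inv_atTop_zero.smul_const x).add_const h
  rw [zero_smul, zero_add] at h2
  exact hR.cone.isClosed.mem_of_tendsto h2 h1

/-- Let `φ` be the second derivative along the ray. Self-concordance gives `|φ'| ≤ 2 φ^(3/2) ≤ 2Cφ`
on a compact interval, so `φ` vanishes by Grönwall. The gradient bound then kills the first
derivative, and a ray on which the barrier is constant cannot exit. -/
lemma forall_add_smul_mem_of_secondDeriv_eq_zero (hR : IsNormalBarrier Ψ ν R) {x h : Vec n}
    (hx : x ∈ interior Ψ) (h0 : secondDeriv R x h h = 0) (s : ℝ) (hs : 0 ≤ s) :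
    x + s • h ∈ interior Ψ := by
  refine hR.mem_interior_of_le (M := R x) hx hs fun r hr0 _ hr => ?_
  have hmem : ∀ t ∈ Set.Icc 0 r, x + t • h ∈ interior Ψ := fun t ht =>
    hR.add_smul_mem_interior hx hr ht.1 ht.2
  have hcont : ContinuousOn (fun t : ℝ => secondDeriv R (x + t • h) h h) (Set.Icc 0 r) :=
    fun t ht => (hR.hasDerivAt_secondDeriv_line (hmem t ht)).continuousAt.continuousWithinAt
  obtain ⟨C, hC⟩ := isCompact_Icc.exists_bound_of_continuousOn (hcont.sqrt)
  have hz := eq_zero_of_abs_deriv_le_mul_abs_self_of_eq_zero_right (K := 2 * C)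
    (f' := fun t => iteratedFDeriv ℝ 3 R (x + t • h) ![h, h, h]) hcont
    (fun t ht => (hR.hasDerivAt_secondDeriv_line (hmem t ⟨ht.1, ht.2.le⟩)).hasDerivWithinAt)
    (by simpa using h0) (fun t ht => by
      have hm := hmem t ⟨ht.1, ht.2.le⟩
      have h1 := hR.abs_third_le hm h
      have h2 := hC t ⟨ht.1, ht.2.le⟩
      rw [← localNorm_eq, Real.norm_of_nonneg (localNorm_nonneg _ _ _)] at h2
      rw [← hR.localNorm_sq hm, Real.norm_eq_abs, Real.norm_eq_abs,
        abs_of_nonneg (sq_nonneg (localNorm R (x + t • h) h))]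
      refine h1.trans ?_
      nlinarith [localNorm_nonneg R (x + t • h) h, sq_nonneg (localNorm R (x + t • h) h)])
  have hconst := constant_of_has_deriv_right_zero (f := fun t : ℝ => R (x + t • h)) (a := 0) (b := r)
    (fun t ht => (hR.hasDerivAt_comp_line (hmem t ht)).continuousAt.continuousWithinAt)
    (fun t ht => by
      have hm := hmem t ⟨ht.1, ht.2.le⟩
      have h1 := hR.grad_le _ hm h
      rw [localNorm_eq, hz t ⟨ht.1, ht.2.le⟩, Real.sqrt_zero, mul_zero] at h1
      have h2 : fderiv ℝ R (x + t • h) h = 0 := abs_nonpos_iff.1 h1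
      simpa [h2] using (hR.hasDerivAt_comp_line (h := h) hm).hasDerivWithinAt)
  have := hconst r ⟨hr0, le_rfl⟩
  simp only [zero_smul, add_zero] at this
  exact this.le

/-- A degenerate direction would keep both of its rays in the cone, hence put a line in a pointed
cone. -/
lemma secondDeriv_pos (hR : IsNormalBarrier Ψ ν R) {x h : Vec n} (hx : x ∈ interior Ψ)
    (hh : h ≠ 0) : 0 < secondDeriv R x h h := by
  refine (hR.secondDeriv_nonneg hx h).lt_of_ne fun h0 => hh ?_
  have h0' : secondDeriv R x (-h) (-h) = 0 := by
    simpa [secondDeriv] using h0.symm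
  exact hR.cone.pointed h
    (hR.mem_of_forall_add_smul_mem fun s hs => interior_subset
      (hR.forall_add_smul_mem_of_secondDeriv_eq_zero hx h0.symm s hs))
    (hR.mem_of_forall_add_smul_mem fun s hs => interior_subset
      (hR.forall_add_smul_mem_of_secondDeriv_eq_zero hx h0' s hs))

lemma localNorm_pos (hR : IsNormalBarrier Ψ ν R) {x h : Vec n} (hx : x ∈ interior Ψ)
    (hh : h ≠ 0) : 0 < localNorm R x h := by
  rw [localNorm_eq]
  exact Real.sqrt_pos.2 (hR.secondDeriv_pos hx hh)

/-! ### Self-concordance -/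

/-- With `φ` the second derivative along the line, `φ^(-1/2)` has derivative `-φ' / (2 φ^(3/2))`, of
absolute value at most `1`. All comparisons of local norms below follow from this. -/
lemma abs_inv_localNorm_sub_le (hR : IsNormalBarrier Ψ ν R) {x h : Vec n} {s : ℝ}
    (hx : x ∈ interior Ψ) (hs : 0 ≤ s) (hxs : x + s • h ∈ interior Ψ) (hh : h ≠ 0) :
    |(localNorm R (x + s • h) h)⁻¹ - (localNorm R x h)⁻¹| ≤ s := by
  have hmem : ∀ t ∈ Set.Icc 0 s, x + t • h ∈ interior Ψ := fun t ht =>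
    hR.add_smul_mem_interior hx hxs ht.1 ht.2
  have hder : ∀ t ∈ Set.Icc 0 s, HasDerivWithinAt (fun t : ℝ => (localNorm R (x + t • h) h)⁻¹)
      (-(iteratedFDeriv ℝ 3 R (x + t • h) ![h, h, h] / (2 * localNorm R (x + t • h) h)) /
        localNorm R (x + t • h) h ^ 2) (Set.Icc 0 s) t := by
    intro t ht
    have hm := hmem t ht
    have h1 := (hR.hasDerivAt_secondDeriv_line hm).sqrt (hR.secondDeriv_pos hm hh).ne'
    have h2 := h1.inv (Real.sqrt_pos.2 (hR.secondDeriv_pos hm hh)).ne'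
    simp only [localNorm_eq]
    exact h2.hasDerivWithinAt
  have := Convex.norm_image_sub_le_of_norm_hasDerivWithin_le (C := 1) hder ?_ (convex_Icc 0 s)
    (Set.left_mem_Icc.2 hs) (Set.right_mem_Icc.2 hs)
  · simpa [abs_of_nonneg hs] using this
  · intro t ht
    have hm := hmem t ht
    have hp := hR.localNorm_pos hm hh
    have h3 := hR.abs_third_le hm h
    rw [Real.norm_eq_abs, abs_div, abs_neg, abs_div, abs_of_pos (pow_pos hp 2),
      abs_of_pos (mul_pos two_pos hp), div_div, div_le_one (by positivity)]
    calc _ ≤ _ := h3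
      _ = _ := by ring

lemma localNorm_div_le (hR : IsNormalBarrier Ψ ν R) {x h : Vec n} {s : ℝ}
    (hx : x ∈ interior Ψ) (hs : 0 ≤ s) (hxs : x + s • h ∈ interior Ψ) :
    localNorm R x h / (1 + s * localNorm R x h) ≤ localNorm R (x + s • h) h := by
  by_cases hh : h = 0
  · subst hh; simp [localNorm_eq, secondDeriv]
  have h1 := (abs_le.1 (hR.abs_inv_localNorm_sub_le hx hs hxs hh)).2
  have hp := hR.localNorm_pos hx hh
  have hq := hR.localNorm_pos hxs hh
  have h2 : (localNorm R (x + s • h) h)⁻¹ ≤ (1 + s * localNorm R x h) / localNorm R x h := by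
    rw [add_div, mul_div_assoc, div_self hp.ne', one_div]
    linarith
  have h3 := inv_anti₀ (inv_pos.2 hq) h2
  rwa [inv_inv, inv_div] at h3

lemma localNorm_mul_le (hR : IsNormalBarrier Ψ ν R) {x h : Vec n} {s : ℝ}
    (hx : x ∈ interior Ψ) (hs : 0 ≤ s) (hxs : x + s • h ∈ interior Ψ) :
    localNorm R (x + s • h) h * (1 - s * localNorm R x h) ≤ localNorm R x h := by
  by_cases hh : h = 0
  · subst hh; simp [localNorm_eq, secondDeriv]
  have h1 := (abs_le.1 (hR.abs_inv_localNorm_sub_le hx hs hxs hh)).1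
  have hp := hR.localNorm_pos hx hh
  have hq := hR.localNorm_pos hxs hh
  have h2 : (localNorm R x h)⁻¹ - s ≤ (localNorm R (x + s • h) h)⁻¹ := by linarith
  have h3 := mul_le_mul_of_nonneg_left h2 (mul_pos hp hq).le
  have e1 : localNorm R x h * localNorm R (x + s • h) h * ((localNorm R x h)⁻¹ - s) =
      localNorm R (x + s • h) h * (1 - s * localNorm R x h) := by field_simp
  have e2 : localNorm R x h * localNorm R (x + s • h) h * (localNorm R (x + s • h) h)⁻¹ =
      localNorm R x h := by field_simp
  rwa [e1, e2] at h3

/-- Integrates the square of `localNorm_div_le`: the integral of `(a / (1 + a t))²` over `[0, s]` is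
`a² s / (1 + a s)`. -/
lemma sq_div_le_fderiv_sub (hR : IsNormalBarrier Ψ ν R) {x h : Vec n} {s : ℝ}
    (hx : x ∈ interior Ψ) (hs : 0 ≤ s) (hxs : x + s • h ∈ interior Ψ) :
    localNorm R x h ^ 2 * s / (1 + localNorm R x h * s) ≤
      fderiv ℝ R (x + s • h) h - fderiv ℝ R x h := by
  set a := localNorm R x h with ha
  have ha0 : 0 ≤ a := localNorm_nonneg _ _ _
  have hmem : ∀ t ∈ Set.Icc 0 s, x + t • h ∈ interior Ψ := fun t ht =>
    hR.add_smul_mem_interior hx hxs ht.1 ht.2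
  have hden : ∀ t ∈ Set.Icc 0 s, 0 < 1 + a * t := fun t ht => by
    have := mul_nonneg ha0 ht.1; linarith
  have hder : ∀ t ∈ Set.Icc 0 s,
      HasDerivAt (fun t : ℝ => fderiv ℝ R (x + t • h) h - a ^ 2 * t / (1 + a * t))
        (secondDeriv R (x + t • h) h h - (a / (1 + a * t)) ^ 2) t := by
    intro t ht
    have h1 : HasDerivAt (fun t : ℝ => a ^ 2 * t / (1 + a * t)) ((a / (1 + a * t)) ^ 2) t := by
      have h2 : HasDerivAt (fun t : ℝ => a ^ 2 * t) (a ^ 2) t := by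
        simpa using (hasDerivAt_id t).const_mul (a ^ 2)
      have h3 : HasDerivAt (fun t : ℝ => 1 + a * t) a t := by
        simpa using ((hasDerivAt_id t).const_mul a).const_add 1
      refine (h2.div h3 (hden t ht).ne').congr_deriv ?_
      rw [div_pow]; congr 1; ring
    exact (hR.hasDerivAt_fderiv_line (hmem t ht)).sub h1
  have hmono := monotoneOn_of_deriv_nonneg (convex_Icc 0 s)
    (fun t ht => (hder t ht).continuousAt.continuousWithinAt)
    (fun t ht => (hder t (interior_subset ht)).differentiableAt.differentiableWithinAt)
    (fun t ht => by
      have ht' := interior_subset ht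
      rw [(hder t ht').deriv, sub_nonneg, ← hR.localNorm_sq (hmem t ht')]
      have h1 := hR.localNorm_div_le hx ht'.1 (hmem t ht')
      rw [mul_comm t] at h1
      exact pow_le_pow_left₀ (div_nonneg ha0 (hden t ht').le) h1 2)
  have := hmono (Set.left_mem_Icc.2 hs) (Set.right_mem_Icc.2 hs) hs
  simp only [zero_smul, add_zero, mul_zero, zero_div, sub_zero] at this
  linarith

/-- A second integration. This gain plays the role that strong convexity has for a quadratic
regularizer. -/
lemma localNorm_sub_log_le (hR : IsNormalBarrier Ψ ν R) {x h : Vec n}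
    (hx : x ∈ interior Ψ) (hxh : x + h ∈ interior Ψ) :
    localNorm R x h - Real.log (1 + localNorm R x h) ≤ R (x + h) - R x - fderiv ℝ R x h := by
  set a := localNorm R x h with ha
  have ha0 : 0 ≤ a := localNorm_nonneg _ _ _
  have hmem : ∀ t ∈ Set.Icc (0 : ℝ) 1, x + t • h ∈ interior Ψ := fun t ht =>
    hR.add_smul_mem_interior hx (by simpa using hxh) ht.1 ht.2
  have hden : ∀ t ∈ Set.Icc (0 : ℝ) 1, 0 < 1 + a * t := fun t ht => by
    have := mul_nonneg ha0 ht.1; linarith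
  have hder : ∀ t ∈ Set.Icc (0 : ℝ) 1,
      HasDerivAt (fun t : ℝ => R (x + t • h) - fderiv ℝ R x h * t - (a * t - Real.log (1 + a * t)))
        (fderiv ℝ R (x + t • h) h - fderiv ℝ R x h - a ^ 2 * t / (1 + a * t)) t := by
    intro t ht
    have h2 : HasDerivAt (fun t : ℝ => a * t) a t := by
      simpa using (hasDerivAt_id t).const_mul a
    have h3 := h2.sub ((h2.const_add 1).log (hden t ht).ne')
    have h4 : HasDerivAt (fun t : ℝ => fderiv ℝ R x h * t) (fderiv ℝ R x h) t := by
      simpa using (hasDerivAt_id t).const_mul (fderiv ℝ R x h)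
    refine (((hR.hasDerivAt_comp_line (hmem t ht)).sub h4).sub h3).congr_deriv ?_
    have := (hden t ht).ne'
    field_simp
    ring
  have hmono := monotoneOn_of_deriv_nonneg (convex_Icc 0 1)
    (fun t ht => (hder t ht).continuousAt.continuousWithinAt)
    (fun t ht => (hder t (interior_subset ht)).differentiableAt.differentiableWithinAt)
    (fun t ht => by
      have ht' := interior_subset ht
      rw [(hder t ht').deriv, sub_nonneg]
      exact hR.sq_div_le_fderiv_sub hx ht'.1 (hmem t ht'))
  have := hmono (Set.left_mem_Icc.2 zero_le_one) (Set.right_mem_Icc.2 zero_le_one) zero_le_one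
  simp at this
  linarith

/-- The open Dikin ellipsoid is contained in the interior of the cone. -/
lemma add_mem_interior (hR : IsNormalBarrier Ψ ν R) {x h : Vec n}
    (hx : x ∈ interior Ψ) (hh : localNorm R x h < 1) : x + h ∈ interior Ψ := by
  set a := localNorm R x h with ha
  have ha0 : 0 ≤ a := localNorm_nonneg _ _ _
  -- By convexity the barrier rises by at most `r` times its slope at `x + r • h`. The gradient
  -- bound and `localNorm_mul_le` control that slope up to `r = 1`, so the segment cannot exit.
  have key : ∀ r : ℝ, 0 ≤ r → r ≤ 1 → x + r • h ∈ interior Ψ →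
      R (x + r • h) ≤ R x + √ν * (a / (1 - a)) := by
    intro r h0 h1 hr
    have hg : fderiv ℝ R (x + r • h) (-(r • h)) ≤ R x - R (x + r • h) := by
      have := hR.fderiv_le_sub hr hx
      rwa [sub_add_cancel_left] at this
    have hb := (abs_le.1 (hR.grad_le _ hr h)).2
    have hn : localNorm R (x + r • h) h ≤ a / (1 - a) := by
      rw [le_div_iff₀ (by linarith)]
      refine le_trans ?_ (hR.localNorm_mul_le hx h0 hr)
      refine mul_le_mul_of_nonneg_left ?_ (localNorm_nonneg _ _ _)
      nlinarith
    rw [map_neg, map_smul, smul_eq_mul] at hg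
    have hN := mul_le_mul_of_nonneg_left hn (Real.sqrt_nonneg ν)
    have hpos : 0 ≤ √ν * (a / (1 - a)) :=
      mul_nonneg (Real.sqrt_nonneg _) (div_nonneg ha0 (by linarith))
    nlinarith
  simpa using hR.mem_interior_of_le hx zero_le_one key

/-! ### Logarithmic homogeneity -/

lemma smul_mem_interior (hR : IsNormalBarrier Ψ ν R) {x : Vec n} (hx : x ∈ interior Ψ) {c : ℝ}
    (hc : 0 < c) : c • x ∈ interior Ψ := by
  have h1 : c • x ∈ interior ((fun y => c • y) '' Ψ) := by
    have h2 := (Homeomorph.smulOfNeZero (α := Vec n) c hc.ne').image_interior Ψ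
    exact h2 ▸ ⟨x, hx, rfl⟩
  refine interior_mono ?_ h1
  rintro _ ⟨y, hy, rfl⟩
  exact hR.cone.smul_mem y hy c hc.le

lemma add_mem_interior_of_mem (hR : IsNormalBarrier Ψ ν R) {x y : Vec n}
    (hx : x ∈ interior Ψ) (hy : y ∈ interior Ψ) : x + y ∈ interior Ψ := by
  have h1 := hR.cone.convex.interior hx hy (a := 1 / 2) (b := 1 / 2)
    (by norm_num) (by norm_num) (by norm_num)
  have h2 := hR.smul_mem_interior h1 two_pos
  convert h2 using 1
  module

lemma fderiv_self (hR : IsNormalBarrier Ψ ν R) {x : Vec n} (hx : x ∈ interior Ψ) :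
    fderiv ℝ R x x = -ν := by
  have h1 : HasDerivAt (fun s : ℝ => R (x + s • x)) (fderiv ℝ R x x) 0 := by
    simpa using hR.hasDerivAt_comp_line (s := 0) (h := x) (line_zero_mem hx)
  have h2 : HasDerivAt (fun s : ℝ => R x - ν * Real.log (1 + s)) (-ν) 0 := by
    have := ((((hasDerivAt_id (0 : ℝ)).const_add 1).log (by simp)).const_mul ν).const_sub (R x)
    simpa using this
  refine h1.unique (h2.congr_of_eventuallyEq ?_)
  filter_upwards [lt_mem_nhds (show (-1 : ℝ) < 0 by norm_num)] with s hs
  rw [← hR.log_homogeneous x hx (1 + s) (by linarith), add_smul, one_smul]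

lemma fderiv_smul (hR : IsNormalBarrier Ψ ν R) {x : Vec n} (hx : x ∈ interior Ψ) {c : ℝ}
    (hc : 0 < c) (h : Vec n) : fderiv ℝ R (c • x) h = c⁻¹ * fderiv ℝ R x h := by
  have h1 := hR.hasDerivAt_comp_line (s := 0) (h := h) (line_zero_mem hx)
  have h2 := hR.hasDerivAt_comp_line (x := c • x) (s := 0) (h := c • h)
    (line_zero_mem (hR.smul_mem_interior hx hc))
  have hcont : ContinuousAt (fun s : ℝ => x + s • h) 0 := by fun_prop
  have hev : ∀ᶠ s in 𝓝 (0 : ℝ), x + s • h ∈ interior Ψ :=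
    hcont (isOpen_interior.mem_nhds (by simpa using hx))
  have h3 := (h2.congr_of_eventuallyEq (f₁ := fun s => R (x + s • h) - ν * Real.log c) ?_).unique
    (h1.sub_const _)
  · simp only [zero_smul, add_zero, map_smul, smul_eq_mul] at h3
    rw [← h3]
    field_simp
  · filter_upwards [hev] with s hs
    rw [← hR.log_homogeneous _ hs c hc, smul_add, smul_comm c s h]

/-- Differentiate `∇R(c x) = c⁻¹ ∇R(x)` in `c` at `c = 1`. -/
lemma secondDeriv_self_left (hR : IsNormalBarrier Ψ ν R) {x : Vec n} (hx : x ∈ interior Ψ)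
    (h : Vec n) : secondDeriv R x x h = -fderiv ℝ R x h := by
  have h1 : HasDerivAt (fun s : ℝ => fderiv ℝ R (x + s • x) h) (secondDeriv R x x h) 0 := by
    simpa using hR.hasDerivAt_fderiv_line (s := 0) (h := x) (k := h) (line_zero_mem hx)
  have h2 : HasDerivAt (fun s : ℝ => (1 + s)⁻¹ * fderiv ℝ R x h) (-fderiv ℝ R x h) 0 := by
    have := (((hasDerivAt_id (0 : ℝ)).const_add 1).inv (by simp)).mul_const (fderiv ℝ R x h)
    simpa using this
  refine h1.unique (h2.congr_of_eventuallyEq ?_)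
  filter_upwards [lt_mem_nhds (show (-1 : ℝ) < 0 by norm_num)] with s hs
  rw [← hR.fderiv_smul hx (by linarith), add_smul, one_smul]

lemma secondDeriv_comm (hR : IsNormalBarrier Ψ ν R) {x : Vec n} (hx : x ∈ interior Ψ)
    (h k : Vec n) : secondDeriv R x h k = secondDeriv R x k h :=
  ((hR.contDiffAt hx).isSymmSndFDerivAt (by simp; norm_num)) h k

/-- A positive slope would make the tangent at `x` grow linearly along `t • y`, while `R (t • y)`
decreases like `-ν log t`. -/
lemma fderiv_nonpos (hR : IsNormalBarrier Ψ ν R) {x y : Vec n} (hx : x ∈ interior Ψ)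
    (hy : y ∈ interior Ψ) : fderiv ℝ R x y ≤ 0 := by
  have hν : 0 ≤ ν := zero_le_one.trans hR.one_le
  have h1 : ∀ t : ℝ, 1 ≤ t → t * fderiv ℝ R x y ≤ R y - R x := by
    intro t ht
    have ht0 : 0 < t := by linarith
    have h2 := hR.fderiv_le_sub hx (hR.smul_mem_interior hy ht0)
    rw [map_sub, map_smul, smul_eq_mul, hR.fderiv_self hx, hR.log_homogeneous y hy t ht0] at h2
    have := mul_nonneg hν (Real.log_nonneg ht)
    linarith
  by_contra! hpos
  have h3 := h1 (max 1 ((R y - R x + 1) / fderiv ℝ R x y)) (le_max_left _ _)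
  have h4 := mul_le_mul_of_nonneg_right
    (le_max_right 1 ((R y - R x + 1) / fderiv ℝ R x y)) hpos.le
  rw [div_mul_cancel₀ _ hpos.ne'] at h4
  linarith

lemma add_le (hR : IsNormalBarrier Ψ ν R) {x y : Vec n} (hx : x ∈ interior Ψ)
    (hy : y ∈ interior Ψ) : R (x + y) ≤ R x := by
  have hxy := hR.add_mem_interior_of_mem hx hy
  have h1 := hR.fderiv_le_sub hxy hx
  have h2 := hR.fderiv_nonpos hxy hy
  rw [sub_add_cancel_left, map_neg] at h1
  linarith

/-- Along `x + t • y` the slope stays nonpositive, so it rises by at most `b`; by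
`sq_div_le_fderiv_sub` it rises by at least `a² t / (1 + a t)`, which tends to `a`. -/
lemma localNorm_le_neg_fderiv (hR : IsNormalBarrier Ψ ν R) {x y : Vec n} (hx : x ∈ interior Ψ)
    (hy : y ∈ interior Ψ) : localNorm R x y ≤ -fderiv ℝ R x y := by
  set a := localNorm R x y with ha
  set b := -fderiv ℝ R x y with hb
  have hb0 : 0 ≤ b := by have := hR.fderiv_nonpos hx hy; linarith
  have ha0 : 0 ≤ a := localNorm_nonneg _ _ _
  have key : ∀ t : ℝ, 0 < t → a ^ 2 * t ≤ b * (1 + a * t) := by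
    intro t ht
    have hm := hR.add_mem_interior_of_mem hx (hR.smul_mem_interior hy ht)
    have h1 := hR.sq_div_le_fderiv_sub hx ht.le hm
    have h2 := hR.fderiv_nonpos hm hy
    rw [← ha, div_le_iff₀ (by positivity)] at h1
    refine h1.trans (mul_le_mul_of_nonneg_right (by linarith) (by positivity))
  by_contra! hlt
  have hapos : 0 < a := hb0.trans_lt hlt
  have hden : 0 < a * (a - b) := mul_pos hapos (by linarith)
  -- This `t` makes `a (a - b) t = b + 1`, whereas `key` says it is at most `b`.
  have h1 := key ((b + 1) / (a * (a - b))) (by positivity)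
  have h2 : a * (a - b) * ((b + 1) / (a * (a - b))) = b + 1 := by
    field_simp
  nlinarith

/-- Interior points on the nonnegative side of the gradient at `x` are in the ball of radius `ν` for
the local norm at `x`. -/
lemma localNorm_sub_le (hR : IsNormalBarrier Ψ ν R) {x y : Vec n} (hx : x ∈ interior Ψ)
    (hy : y ∈ interior Ψ) (hg : 0 ≤ fderiv ℝ R x (y - x)) : localNorm R x (y - x) ≤ ν := by
  have hν := hR.one_le
  -- Expand the square with `∇²R(x) x = -∇R(x)` and `∇R(x)ᵀ x = -ν`.
  have h1 : localNorm R x (y - x) ^ 2 = localNorm R x y ^ 2 + 2 * fderiv ℝ R x y + ν := by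
    rw [hR.localNorm_sq hx, hR.localNorm_sq hx]
    have e : secondDeriv R x (y - x) (y - x) = secondDeriv R x y y - secondDeriv R x y x
        - (secondDeriv R x x y - secondDeriv R x x x) := by
      simp only [secondDeriv, map_sub, sub_apply]; ring
    rw [e, hR.secondDeriv_comm hx y x, hR.secondDeriv_self_left hx, hR.secondDeriv_self_left hx,
      hR.fderiv_self hx]
    ring
  have h2 := hR.localNorm_le_neg_fderiv hx hy
  have h0 := localNorm_nonneg R x y
  rw [map_sub, hR.fderiv_self hx] at hg
  refine abs_le_of_sq_le_sq' ?_ (by linarith) |>.2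
  rw [h1]
  -- For `b = -∇R(x)ᵀ y` in `[0, ν]` the square is at most `b² - 2b + ν`, which is at most `ν²`
  -- since `ν ≥ 1`.
  nlinarith

end IsNormalBarrier

/-! ### The scaling matrix -/

lemma mulVecE_mulVecE {n : ℕ} (A B : Matrix (Fin n) (Fin n) ℝ) (z : Vec n) :
    mulVecE A (mulVecE B z) = mulVecE (A * B) z := by
  simp [mulVecE, Matrix.mulVec_mulVec]

lemma mulVecE_one {n : ℕ} (z : Vec n) : mulVecE 1 z = z := by
  simp [mulVecE]

lemma inner_mulVecE_comm {n : ℕ} {A : Matrix (Fin n) (Fin n) ℝ} (hA : Aᵀ = A) (x y : Vec n) :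
    inner ℝ (mulVecE A x) y = inner ℝ x (mulVecE A y) := by
  simp only [mulVecE, EuclideanSpace.inner_eq_star_dotProduct, star_trivial]
  rw [Matrix.dotProduct_mulVec, ← Matrix.mulVec_transpose, hA]

lemma scaling_transpose {n : ℕ} (R : Vec n → ℝ) (x : Vec n) : (scaling R x)ᵀ = scaling R x := by
  have h : IsSelfAdjoint (scaling R x) := cfc_predicate _ _
  rw [← Matrix.conjTranspose_eq_transpose_of_trivial]
  exact h

lemma scaling_inv_transpose {n : ℕ} (R : Vec n → ℝ) (x : Vec n) : (scaling R x)⁻¹ᵀ = (scaling R x)⁻¹ := by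
  rw [Matrix.transpose_nonsing_inv, scaling_transpose]

namespace IsNormalBarrier

variable {n : ℕ} {Ψ : Set (Vec n)} {ν : ℝ} {R : Vec n → ℝ}

lemma posDef_hessian (hR : IsNormalBarrier Ψ ν R) {x : Vec n} (hx : x ∈ interior Ψ) :
    (hessian R x).PosDef := by
  refine Matrix.PosDef.of_dotProduct_mulVec_pos ?_ ?_
  · ext i j
    simp only [Matrix.conjTranspose_apply, hessian_apply, star_trivial]
    exact hR.secondDeriv_comm hx _ _
  · intro v hv
    have h1 := hR.secondDeriv_pos hx (h := WithLp.toLp 2 v) (by simpa using hv)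
    rw [← inner_mulVecE_hessian, EuclideanSpace.inner_eq_star_dotProduct] at h1
    simpa [mulVecE, dotProduct_comm] using h1

lemma isSelfAdjoint_hessian (hR : IsNormalBarrier Ψ ν R) {x : Vec n} (hx : x ∈ interior Ψ) :
    IsSelfAdjoint (hessian R x) :=
  (hR.posDef_hessian hx).isHermitian

lemma spectrum_hessian_pos (hR : IsNormalBarrier Ψ ν R) {x : Vec n} (hx : x ∈ interior Ψ) :
    spectrum ℝ (hessian R x) ⊆ Set.Ioi 0 := by
  rw [(hR.posDef_hessian hx).isHermitian.spectrum_real_eq_range_eigenvalues]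
  rintro _ ⟨i, rfl⟩
  exact (hR.posDef_hessian hx).eigenvalues_pos i

lemma continuousOn_rpow_spectrum (hR : IsNormalBarrier Ψ ν R) {x : Vec n} (hx : x ∈ interior Ψ)
    (p : ℝ) : ContinuousOn (fun s : ℝ => s ^ p) (spectrum ℝ (hessian R x)) :=
  fun _ hs => (Real.continuousAt_rpow_const _ _
    (Or.inl (ne_of_gt (hR.spectrum_hessian_pos hx hs)))).continuousWithinAt

lemma cfc_rpow_mul (hR : IsNormalBarrier Ψ ν R) {x : Vec n} (hx : x ∈ interior Ψ) (p q : ℝ) :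
    cfc (fun s : ℝ => s ^ p) (hessian R x) * cfc (fun s : ℝ => s ^ q) (hessian R x) =
      cfc (fun s : ℝ => s ^ (p + q)) (hessian R x) := by
  rw [← cfc_mul _ _ _ (hR.continuousOn_rpow_spectrum hx p) (hR.continuousOn_rpow_spectrum hx q)]
  exact cfc_congr fun s hs => (Real.rpow_add (hR.spectrum_hessian_pos hx hs) p q).symm

lemma cfc_rpow_zero (hR : IsNormalBarrier Ψ ν R) {x : Vec n} (hx : x ∈ interior Ψ) :
    cfc (fun s : ℝ => s ^ (0 : ℝ)) (hessian R x) = 1 := by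
  have := hR.isSelfAdjoint_hessian hx
  simp only [Real.rpow_zero]
  exact cfc_const_one ℝ (hessian R x)

lemma scaling_mul (hR : IsNormalBarrier Ψ ν R) {x : Vec n} (hx : x ∈ interior Ψ) :
    scaling R x * cfc (fun s : ℝ => s ^ (1 / 2 : ℝ)) (hessian R x) = 1 := by
  rw [scaling, hR.cfc_rpow_mul hx, neg_add_cancel, hR.cfc_rpow_zero hx]

lemma scaling_inv (hR : IsNormalBarrier Ψ ν R) {x : Vec n} (hx : x ∈ interior Ψ) :
    (scaling R x)⁻¹ = cfc (fun s : ℝ => s ^ (1 / 2 : ℝ)) (hessian R x) :=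
  Matrix.inv_eq_right_inv (hR.scaling_mul hx)

lemma scaling_mul_inv (hR : IsNormalBarrier Ψ ν R) {x : Vec n} (hx : x ∈ interior Ψ) :
    scaling R x * (scaling R x)⁻¹ = 1 := by
  rw [hR.scaling_inv hx, hR.scaling_mul hx]

lemma scaling_inv_mul (hR : IsNormalBarrier Ψ ν R) {x : Vec n} (hx : x ∈ interior Ψ) :
    (scaling R x)⁻¹ * scaling R x = 1 :=
  mul_eq_one_comm.1 (hR.scaling_mul_inv hx)

lemma scaling_inv_mul_scaling_inv (hR : IsNormalBarrier Ψ ν R) {x : Vec n}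
    (hx : x ∈ interior Ψ) : (scaling R x)⁻¹ * (scaling R x)⁻¹ = hessian R x := by
  rw [hR.scaling_inv hx, hR.cfc_rpow_mul hx]
  have := hR.isSelfAdjoint_hessian hx
  norm_num
  exact cfc_id' ℝ (hessian R x)

lemma norm_scaling_inv (hR : IsNormalBarrier Ψ ν R) {x : Vec n} (hx : x ∈ interior Ψ)
    (h : Vec n) : ‖mulVecE (scaling R x)⁻¹ h‖ = localNorm R x h := by
  rw [localNorm, ← hR.scaling_inv_mul_scaling_inv hx, ← mulVecE_mulVecE,
    ← inner_mulVecE_comm (scaling_inv_transpose R x), real_inner_self_eq_norm_sq,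
    Real.sqrt_sq (norm_nonneg _)]

lemma localNorm_scaling (hR : IsNormalBarrier Ψ ν R) {x : Vec n} (hx : x ∈ interior Ψ)
    (u : Vec n) : localNorm R x (mulVecE (scaling R x) u) = ‖u‖ := by
  rw [← hR.norm_scaling_inv hx, mulVecE_mulVecE, hR.scaling_inv_mul hx, mulVecE_one]

lemma continuousOn_hessian (hR : IsNormalBarrier Ψ ν R) :
    ContinuousOn (hessian R) (interior Ψ) := by
  refine continuousOn_pi.2 fun i => continuousOn_pi.2 fun j => ?_
  simp only [hessian_apply, secondDeriv]
  have h : ContinuousOn (fderiv ℝ (fderiv ℝ R)) (interior Ψ) := fun x hx =>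
    (hR.contDiffAt_fderiv_fderiv hx).continuousAt.continuousWithinAt
  exact (h.clm_apply continuousOn_const).clm_apply continuousOn_const

lemma continuousOn_scaling (hR : IsNormalBarrier Ψ ν R) :
    ContinuousOn (scaling R) (interior Ψ) := by
  -- The operator norm makes the matrices a C⋆-algebra, where the functional calculus is continuous
  -- for functions continuous near the spectra.
  let _ := Matrix.instL2OpNormedRing (n := Fin n) (𝕜 := ℝ)
  let _ := Matrix.instL2OpNormedAlgebra (n := Fin n) (𝕜 := ℝ)
  have : CStarRing (Matrix (Fin n) (Fin n) ℝ) := Matrix.instCStarRing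
  have : CompleteSpace (Matrix (Fin n) (Fin n) ℝ) := FiniteDimensional.complete ℝ _
  refine ContinuousOn.cfc_of_mem_nhdsSet (s := Set.Ioi (0 : ℝ)) _ ?_ hR.continuousOn_hessian
    (fun x hx => hR.isSelfAdjoint_hessian hx) ?_
  · refine isOpen_Ioi.mem_nhdsSet.2 (Set.iUnion₂_subset fun x hx => hR.spectrum_hessian_pos hx)
  · exact fun s hs => (Real.continuousAt_rpow_const _ _
      (Or.inl (ne_of_gt hs))).continuousWithinAt

lemma continuousOn_scaling_inv (hR : IsNormalBarrier Ψ ν R) :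
    ContinuousOn (fun x => (scaling R x)⁻¹) (interior Ψ) := by
  -- Since `A⁻² = ∇²R`, the inverse is `∇²R · A`.
  have h : ContinuousOn (fun x => hessian R x * scaling R x) (interior Ψ) := fun x hx =>
    (hR.continuousOn_hessian x hx).mul (hR.continuousOn_scaling x hx)
  refine h.congr fun x hx => ?_
  dsimp only
  rw [← hR.scaling_inv_mul_scaling_inv hx, mul_assoc, hR.scaling_inv_mul hx, mul_one]

end IsNormalBarrier

/-! ### Moments of the uniform measure on the sphere -/

section Sphere

variable {E : Type*} [NormedAddCommGroup E] [InnerProductSpace ℝ E] [MeasurableSpace E]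
  [BorelSpace E]

/-- The map induced on the unit sphere by a linear isometry. -/
def sphereMap (L : E ≃ₗᵢ[ℝ] E) (s : Metric.sphere (0 : E) 1) : Metric.sphere (0 : E) 1 :=
  ⟨L s, by simp⟩

lemma measurable_sphereMap (L : E ≃ₗᵢ[ℝ] E) : Measurable (sphereMap L) :=
  (L.continuous.measurable.comp measurable_subtype_coe).subtype_mk

variable [FiniteDimensional ℝ E]

-- The surface measure of `s` is a multiple of the volume of the cone over `s`, and linear
-- isometries preserve cones and volume.
open scoped Pointwise in
lemma map_toSphere (L : E ≃ₗᵢ[ℝ] E) :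
    (volume : Measure E).toSphere.map (sphereMap L) = (volume : Measure E).toSphere := by
  ext s hs
  rw [Measure.map_apply (measurable_sphereMap L) hs, Measure.toSphere_apply' _ hs,
    Measure.toSphere_apply' _ (measurable_sphereMap L hs)]
  congr 1
  have h1 : Set.Ioo (0 : ℝ) 1 • (Subtype.val '' (sphereMap L ⁻¹' s) : Set E) =
      L ⁻¹' (Set.Ioo (0 : ℝ) 1 • (Subtype.val '' s)) := by
    ext z
    simp only [Set.mem_smul, Set.mem_image, Set.mem_preimage]
    constructor
    · rintro ⟨a, ha, _, ⟨w, hw, rfl⟩, rfl⟩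
      exact ⟨a, ha, _, ⟨sphereMap L w, hw, rfl⟩, by simp [sphereMap]⟩
    · rintro ⟨a, ha, _, ⟨w, hw, rfl⟩, hz⟩
      refine ⟨a, ha, L.symm w, ⟨⟨L.symm w, by simp⟩, ?_, rfl⟩, ?_⟩
      · convert hw
        simp [sphereMap]
      · apply L.injective
        simp [hz]
  rw [h1]
  exact MeasurePreserving.measure_preimage_equiv (f := L.toMeasurableEquiv) L.measurePreserving _

lemma map_uniformSphere (L : E ≃ₗᵢ[ℝ] E) : (uniformSphere E).map (sphereMap L) = uniformSphere E := by
  rw [uniformSphere, Measure.map_smul, map_toSphere]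

lemma isProbabilityMeasure_uniformSphere [Nontrivial E] :
    IsProbabilityMeasure (uniformSphere E) := by
  constructor
  rw [uniformSphere, Measure.smul_apply, smul_eq_mul]
  refine ENNReal.inv_mul_cancel ?_ (measure_ne_top _ _)
  rw [Ne, Measure.measure_univ_eq_zero]
  exact Measure.toSphere_ne_zero _

lemma integral_uniformSphere_comp (L : E ≃ₗᵢ[ℝ] E) {g : E → ℝ} (hg : Continuous g) :
    ∫ s, g (L s) ∂uniformSphere E = ∫ s, g s ∂uniformSphere E := by
  conv_rhs => rw [← map_uniformSphere L]
  have h := integral_map (measurable_sphereMap L).aemeasurable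
    (μ := uniformSphere E) (hg.comp continuous_subtype_val).aestronglyMeasurable
  exact h.symm

lemma integrable_uniformSphere [Nontrivial E] {g : E → ℝ} (hg : Continuous g) :
    Integrable (fun s : Metric.sphere (0 : E) 1 => g s) (uniformSphere E) := by
  have := isProbabilityMeasure_uniformSphere (E := E)
  have : CompactSpace (Metric.sphere (0 : E) 1) :=
    isCompact_iff_compactSpace.1 (isCompact_sphere _ _)
  exact (hg.comp continuous_subtype_val).integrable_of_hasCompactSupport
    (HasCompactSupport.of_compactSpace _)

lemma integral_inner_uniformSphere (w : E) : ∫ s, inner ℝ w (s : E) ∂uniformSphere E = 0 := by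
  have h := integral_uniformSphere_comp (LinearIsometryEquiv.neg ℝ (E := E))
    (g := fun z => inner ℝ w z) (by fun_prop)
  simp only [LinearIsometryEquiv.coe_neg, inner_neg_right, integral_neg] at h
  linarith

/-- A reflection exchanges two vectors of equal norm and preserves the uniform measure. -/
lemma integral_inner_sq_eq {v w : E} (h : ‖v‖ = ‖w‖) :
    ∫ s, (inner ℝ v (s : E)) ^ 2 ∂uniformSphere E =
      ∫ s, (inner ℝ w (s : E)) ^ 2 ∂uniformSphere E := by
  set L : E ≃ₗᵢ[ℝ] E := (ℝ ∙ (v - w))ᗮ.reflection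
  have hL : L v = w := Submodule.reflection_sub h
  rw [← integral_uniformSphere_comp L (g := fun z => (inner ℝ w z) ^ 2) (by fun_prop)]
  rw [← hL]
  simp only [LinearIsometryEquiv.inner_map_map]

/-- All vectors of an orthonormal basis have the same second moment, and these moments sum to `1`.
-/
lemma integral_inner_sq [Nontrivial E] (w : E) :
    ∫ s, (inner ℝ w (s : E)) ^ 2 ∂uniformSphere E = ‖w‖ ^ 2 / Module.finrank ℝ E := by
  have := isProbabilityMeasure_uniformSphere (E := E)
  set b := stdOrthonormalBasis ℝ E
  have hn : (0 : ℝ) < Module.finrank ℝ E := by exact_mod_cast Module.finrank_pos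
  have hi : ∀ i, ∫ s, (inner ℝ w (s : E)) ^ 2 ∂uniformSphere E =
      ‖w‖ ^ 2 * ∫ s, (inner ℝ (b i) (s : E)) ^ 2 ∂uniformSphere E := by
    intro i
    rw [integral_inner_sq_eq (w := ‖w‖ • b i) (by simp [norm_smul])]
    simp only [real_inner_smul_left, mul_pow]
    rw [integral_const_mul]
  have hsum : ∑ i, ∫ s, (inner ℝ (b i) (s : E)) ^ 2 ∂uniformSphere E = 1 := by
    rw [← integral_finsetSum _ fun i _ =>
      integrable_uniformSphere (g := fun z : E => (inner ℝ (b i) z) ^ 2) (by fun_prop)]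
    have : ∀ s : Metric.sphere (0 : E) 1, ∑ i, (inner ℝ (b i) (s : E)) ^ 2 = 1 := by
      intro s
      have := b.sum_sq_norm_inner_right (s : E)
      simpa using this
    simp [this]
  have hs : ∑ _i : Fin (Module.finrank ℝ E), ∫ s, (inner ℝ w (s : E)) ^ 2 ∂uniformSphere E =
      ‖w‖ ^ 2 := by
    rw [Finset.sum_congr rfl fun i _ => hi i, ← Finset.mul_sum, hsum, mul_one]
  rw [Finset.sum_const, Finset.card_univ, Fintype.card_fin, nsmul_eq_mul] at hs
  rw [eq_div_iff hn.ne', mul_comm, hs]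

lemma integral_inner_mul_inner [Nontrivial E] (v w : E) :
    ∫ s, inner ℝ v (s : E) * inner ℝ w (s : E) ∂uniformSphere E =
      inner ℝ v w / Module.finrank ℝ E := by
  have e : ∀ s : Metric.sphere (0 : E) 1, inner ℝ v (s : E) * inner ℝ w (s : E) =
      1 / 4 * ((inner ℝ (v + w) (s : E)) ^ 2 - (inner ℝ (v - w) (s : E)) ^ 2) := by
    intro s
    rw [inner_add_left, inner_sub_left]
    ring
  simp only [e]
  rw [integral_const_mul, integral_sub
    (integrable_uniformSphere (g := fun z : E => (inner ℝ (v + w) z) ^ 2) (by fun_prop))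
    (integrable_uniformSphere (g := fun z : E => (inner ℝ (v - w) z) ^ 2) (by fun_prop)),
    integral_inner_sq, integral_inner_sq, norm_add_sq_real, norm_sub_sq_real]
  ring

end Sphere

/-! ### The uniform measure on the sphere of a hyperplane -/

section Perp

variable {d : ℕ}

lemma finrank_orthogonal_span {v : Vec (d + 1)} (hv : v ≠ 0) :
    Module.finrank ℝ ((ℝ ∙ v)ᗮ : Submodule ℝ (Vec (d + 1))) = d := by
  have h1 := (ℝ ∙ v).finrank_add_finrank_orthogonal
  rw [finrank_span_singleton hv, finrank_euclideanSpace_fin] at h1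
  omega

lemma nontrivial_orthogonal_span (hd : 1 ≤ d) {v : Vec (d + 1)} (hv : v ≠ 0) :
    Nontrivial ((ℝ ∙ v)ᗮ : Submodule ℝ (Vec (d + 1))) :=
  Module.nontrivial_of_finrank_pos (R := ℝ) (by rw [finrank_orthogonal_span hv]; omega)

lemma measurable_coe_sphere {n : ℕ} (v : Vec n) :
    Measurable fun s : Metric.sphere (0 : ((ℝ ∙ v)ᗮ : Submodule ℝ (Vec n))) 1 => (s.1 : Vec n) :=
  measurable_subtype_coe.comp measurable_subtype_coe

lemma isProbabilityMeasure_uniformPerp (hd : 1 ≤ d) {v : Vec (d + 1)} (hv : v ≠ 0) :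
    IsProbabilityMeasure (uniformPerp v) := by
  have := nontrivial_orthogonal_span hd hv
  have := isProbabilityMeasure_uniformSphere (E := ((ℝ ∙ v)ᗮ : Submodule ℝ (Vec (d + 1))))
  exact Measure.isProbabilityMeasure_map (measurable_coe_sphere v).aemeasurable

lemma uniformPerp_real_compl {n : ℕ} (v : Vec n) :
    (uniformPerp v).real ({z | ‖z‖ = 1 ∧ inner ℝ v z = 0} : Set (Vec n))ᶜ = 0 := by
  have hmeas : MeasurableSet ({z | ‖z‖ = 1 ∧ inner ℝ v z = 0} : Set (Vec n)) :=
    (measurableSet_eq_fun (by fun_prop) (by fun_prop)).inter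
      (measurableSet_eq_fun (by fun_prop) (by fun_prop))
  rw [measureReal_def, uniformPerp, Measure.map_apply (measurable_coe_sphere v) hmeas.compl]
  refine (congrArg ENNReal.toReal ((congrArg _ ?_).trans measure_empty)).trans ENNReal.toReal_zero
  ext s
  simp only [Set.mem_preimage, Set.mem_compl_iff, Set.mem_ofPred_eq, Set.mem_empty_iff_false,
    iff_false, not_not]
  refine ⟨?_, Submodule.mem_orthogonal_singleton_iff_inner_right.1 s.1.2⟩
  exact mem_sphere_zero_iff_norm.1 s.2

lemma integral_uniformPerp {n : ℕ} (v : Vec n) {g : Vec n → ℝ} (hg : Continuous g) :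
    ∫ z, g z ∂uniformPerp v =
      ∫ s, g (s.1 : Vec n) ∂uniformSphere ((ℝ ∙ v)ᗮ : Submodule ℝ (Vec n)) := by
  rw [uniformPerp, integral_map (measurable_coe_sphere v).aemeasurable hg.aestronglyMeasurable]

lemma integrable_uniformPerp (hd : 1 ≤ d) {v : Vec (d + 1)} (hv : v ≠ 0) {g : Vec (d + 1) → ℝ}
    (hg : Continuous g) : Integrable g (uniformPerp v) := by
  have := nontrivial_orthogonal_span hd hv
  rw [uniformPerp, integrable_map_measure hg.aestronglyMeasurable
    (measurable_coe_sphere v).aemeasurable]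
  exact integrable_uniformSphere (E := ((ℝ ∙ v)ᗮ : Submodule ℝ (Vec (d + 1))))
    (g := fun z => g z) (hg.comp continuous_subtype_val)

lemma inner_coe_orthogonal {n : ℕ} (v w : Vec n) (z : ((ℝ ∙ v)ᗮ : Submodule ℝ (Vec n))) :
    inner ℝ w (z : Vec n) = inner ℝ ((ℝ ∙ v)ᗮ.orthogonalProjectionOnto w) z :=
  (Submodule.inner_orthogonalProjectionOnto_eq_of_mem_right z w).symm

lemma integral_inner_uniformPerp {n : ℕ} (v w : Vec n) :
    ∫ z, inner ℝ w z ∂uniformPerp v = 0 := by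
  rw [integral_uniformPerp v (by fun_prop)]
  simp only [inner_coe_orthogonal]
  exact integral_inner_uniformSphere _

/-- Only `k` has to lie in the hyperplane: `w` can be replaced by its projection. The factor `d` of
the estimator cancels this `1 / d`. -/
lemma integral_inner_mul_inner_uniformPerp (hd : 1 ≤ d) {v : Vec (d + 1)} (hv : v ≠ 0)
    (w : Vec (d + 1)) {k : Vec (d + 1)} (hk : inner ℝ v k = 0) :
    ∫ z, inner ℝ w z * inner ℝ k z ∂uniformPerp v = inner ℝ w k / d := by
  have := nontrivial_orthogonal_span hd hv
  rw [integral_uniformPerp v (g := fun z => inner ℝ w z * inner ℝ k z) (by fun_prop)]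
  simp only [inner_coe_orthogonal]
  rw [integral_inner_mul_inner, finrank_orthogonal_span hv]
  have hk' : k ∈ ((ℝ ∙ v)ᗮ : Submodule ℝ (Vec (d + 1))) :=
    Submodule.mem_orthogonal_singleton_iff_inner_right.2 hk
  have e := inner_coe_orthogonal v w ⟨k, hk'⟩
  rw [← (ℝ ∙ v)ᗮ.orthogonalProjectionOnto_mem_subspace_eq_self ⟨k, hk'⟩] at e
  rw [← e, Submodule.orthogonalProjectionOnto_mem_subspace_eq_self]

end Perp

/-! ### Conditional laws -/

section ConditionalLaw

variable {Ω β V : Type*} [mΩ : MeasurableSpace Ω] {mβ : MeasurableSpace β} [MeasurableSpace V]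
  [StandardBorelSpace V] [Nonempty V] {P : Measure Ω} [IsProbabilityMeasure P]
  {X : Ω → β} {Y : Ω → V} {κ : Ω → Measure V}

/-- The exceptional null set depends on `B`. A countable generating algebra makes it common to all
its members, and uniqueness on a π-system identifies the measures. -/
lemma condDistrib_ae_eq_of_condExp_indicator (hX : Measurable X) (hY : Measurable Y)
    (hκ : ∀ ω, IsProbabilityMeasure (κ ω))
    (h : ∀ B : Set V, MeasurableSet B →
      P[(Y ⁻¹' B).indicator (fun _ => (1 : ℝ)) | mβ.comap X] =ᵐ[P] fun ω => (κ ω).real B) :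
    ∀ᵐ ω ∂P, condDistrib Y X P (X ω) = κ ω := by
  set 𝒜 := generateSetAlgebra (MeasurableSpace.countableGeneratingSet V) with h𝒜
  have hcount : 𝒜.Countable :=
    countable_generateSetAlgebra MeasurableSpace.countable_countableGeneratingSet
  have hgen : ‹MeasurableSpace V› = MeasurableSpace.generateFrom 𝒜 := by
    rw [h𝒜, generateFrom_generateSetAlgebra_eq,
      MeasurableSpace.generateFrom_countableGeneratingSet]
  have hpi : IsPiSystem 𝒜 := fun s hs t ht _ =>
    (isSetAlgebra_generateSetAlgebra).inter_mem hs ht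
  have hmeas : ∀ s ∈ 𝒜, MeasurableSet s := fun s hs => by
    rw [hgen]; exact MeasurableSpace.measurableSet_generateFrom hs
  have hall : ∀ᵐ ω ∂P, ∀ s ∈ 𝒜, (condDistrib Y X P (X ω)).real s = (κ ω).real s := by
    refine (ae_ball_iff hcount).2 fun s hs => ?_
    filter_upwards [condDistrib_ae_eq_condExp (μ := P) hX hY (hmeas s hs), h s (hmeas s hs)]
      with ω h1 h2
    rw [h1]
    exact h2
  filter_upwards [hall] with ω hω
  have := hκ ω
  refine ext_of_generate_finite 𝒜 hgen hpi (fun s hs => ?_) (by simp)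
  exact (ENNReal.toReal_eq_toReal_iff' (measure_ne_top _ _) (measure_ne_top _ _)).1 (hω s hs)

/-- If the integral of `Φ` against the conditional law of `Y` vanishes, so does its expectation. -/
lemma integral_eq_zero_of_condExp_indicator (hX : Measurable X) (hY : Measurable Y)
    (hκ : ∀ ω, IsProbabilityMeasure (κ ω))
    (h : ∀ B : Set V, MeasurableSet B →
      P[(Y ⁻¹' B).indicator (fun _ => (1 : ℝ)) | mβ.comap X] =ᵐ[P] fun ω => (κ ω).real B)
    {Φ : β × V → ℝ} (hΦ : Measurable Φ) (hint : Integrable (fun ω => Φ (X ω, Y ω)) P)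
    (hzero : ∀ ω, ∫ y, Φ (X ω, y) ∂κ ω = 0) :
    ∫ ω, Φ (X ω, Y ω) ∂P = 0 := by
  rw [← integral_condExp hX.comap_le]
  refine integral_eq_zero_of_ae ?_
  filter_upwards [condExp_prod_ae_eq_integral_condDistrib hX hY.aemeasurable
    hΦ.stronglyMeasurable hint, condDistrib_ae_eq_of_condExp_indicator hX hY hκ h] with ω h1 h2
  rw [h1, h2, hzero ω]
  rfl

lemma ae_of_condExp_indicator (hX : Measurable X) (hY : Measurable Y)
    (hκ : ∀ ω, IsProbabilityMeasure (κ ω))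
    (h : ∀ B : Set V, MeasurableSet B →
      P[(Y ⁻¹' B).indicator (fun _ => (1 : ℝ)) | mβ.comap X] =ᵐ[P] fun ω => (κ ω).real B)
    {p : β × V → Prop} (hp : MeasurableSet {z | p z})
    (hzero : ∀ ω, κ ω {y | ¬ p (X ω, y)} = 0) : ∀ᵐ ω ∂P, p (X ω, Y ω) := by
  have h0 := integral_eq_zero_of_condExp_indicator hX hY hκ h
    (Φ := {z | ¬ p z}.indicator fun _ => (1 : ℝ)) (measurable_const.indicator hp.compl) ?_ ?_
  · have e : (fun ω => {z | ¬ p z}.indicator (fun _ => (1 : ℝ)) (X ω, Y ω)) =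
        {ω | ¬ p (X ω, Y ω)}.indicator (fun _ => (1 : ℝ)) := rfl
    have hm : MeasurableSet {ω | ¬ p (X ω, Y ω)} := (hX.prodMk hY) hp.compl
    rw [e, integral_indicator_const _ hm, smul_eq_mul, mul_one, measureReal_eq_zero_iff] at h0
    exact h0
  · have e : (fun ω => {z | ¬ p z}.indicator (fun _ => (1 : ℝ)) (X ω, Y ω)) =
        {ω | ¬ p (X ω, Y ω)}.indicator (fun _ => (1 : ℝ)) := rfl
    rw [e]
    exact (integrable_const _).indicator ((hX.prodMk hY) hp.compl)
  · intro ω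
    have e : (fun y => {z | ¬ p z}.indicator (fun _ => (1 : ℝ)) (X ω, y)) =
        {y | ¬ p (X ω, y)}.indicator (fun _ => (1 : ℝ)) := rfl
    have hm : MeasurableSet {y | ¬ p (X ω, y)} := measurable_prodMk_left hp.compl
    rw [e, integral_indicator_const _ hm, measureReal_def, hzero ω]
    simp

end ConditionalLaw

/-! ### The lifted ball -/

section Geometry

variable {d : ℕ}

@[simp] lemma firstCoords_apply (z : Vec (d + 1)) (i : Fin d) : firstCoords z i = z i.castSucc := rfl

@[simp] lemma pair_castSucc (x : Vec d) (b : ℝ) (i : Fin d) : pair x b i.castSucc = x i := by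
  simp [pair]

@[simp] lemma pair_last (x : Vec d) (b : ℝ) : pair x b (Fin.last d) = b := by
  simp [pair]

@[simp] lemma firstCoords_pair (x : Vec d) (b : ℝ) : firstCoords (pair x b) = x := by
  ext i; simp

lemma pair_firstCoords (z : Vec (d + 1)) : pair (firstCoords z) (z (Fin.last d)) = z := by
  ext i
  induction i using Fin.lastCases <;> simp

lemma firstCoords_add (z w : Vec (d + 1)) :
    firstCoords (z + w) = firstCoords z + firstCoords w := by
  ext i; simp

lemma firstCoords_sub (z w : Vec (d + 1)) :
    firstCoords (z - w) = firstCoords z - firstCoords w := by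
  ext i; simp

lemma firstCoords_smul (c : ℝ) (z : Vec (d + 1)) : firstCoords (c • z) = c • firstCoords z := by
  ext i; simp

lemma continuous_firstCoords : Continuous (firstCoords : Vec (d + 1) → Vec d) := by
  unfold firstCoords
  fun_prop

lemma inner_firstCoords (θ : Vec d) (z : Vec (d + 1)) :
    inner ℝ θ (firstCoords z) = inner ℝ (pair θ 0) z := by
  simp [PiLp.inner_apply, Fin.sum_univ_castSucc]

lemma mem_con_of_norm_le {D : ℝ} {z : Vec (d + 1)} (hpos : 0 < z (Fin.last d))
    (h : ‖firstCoords z‖ ≤ D * z (Fin.last d)) : z ∈ con (Metric.closedBall (0 : Vec d) D) := by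
  refine Or.inr ⟨firstCoords z, z (Fin.last d), hpos, ?_, (pair_firstCoords z).symm⟩
  rw [mem_closedBall_zero_iff, norm_smul, Real.norm_of_nonneg (by positivity), one_div,
    inv_mul_le_iff₀ hpos, mul_comm]
  exact h

lemma mem_interior_con {D : ℝ} (hD : 0 < D) {z : Vec (d + 1)}
    (h : ‖firstCoords z‖ < D * z (Fin.last d)) :
    z ∈ interior (con (Metric.closedBall (0 : Vec d) D)) := by
  refine mem_interior.2 ⟨{z | ‖firstCoords z‖ < D * z (Fin.last d)}, fun w hw => ?_,
    isOpen_lt continuous_firstCoords.norm (by fun_prop), h⟩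
  have hw' : ‖firstCoords w‖ < D * w (Fin.last d) := hw
  have : 0 < D * w (Fin.last d) := (norm_nonneg _).trans_lt hw'
  exact mem_con_of_norm_le (pos_of_mul_pos_right this hD.le) hw'.le

lemma norm_firstCoords_le_of_mem_con {D : ℝ} {z : Vec (d + 1)}
    (hz : z ∈ con (Metric.closedBall (0 : Vec d) D)) (hlast : z (Fin.last d) = 1) :
    ‖firstCoords z‖ ≤ D := by
  rcases hz with hz | ⟨x, b, hb, hx, rfl⟩
  · rw [Set.mem_singleton_iff] at hz
    subst hz
    simp at hlast
  · rw [pair_last] at hlast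
    subst hlast
    simpa using hx

lemma mem_lift_shrink_iff {D δ : ℝ} (hδ : δ < 1) {z : Vec (d + 1)} :
    z ∈ lift (shrink δ (Metric.closedBall (0 : Vec d) D)) ↔
      ‖firstCoords z‖ ≤ (1 - δ) * D ∧ z (Fin.last d) = 1 := by
  have h1 : 0 < 1 - δ := by linarith
  have key : ∀ x : Vec d, x ∈ shrink δ (Metric.closedBall (0 : Vec d) D) ↔ ‖x‖ ≤ (1 - δ) * D := by
    intro x
    rw [shrink, Set.mem_ofPred_eq, mem_closedBall_zero_iff, norm_smul,
      Real.norm_of_nonneg (by positivity), one_div, inv_mul_le_iff₀ h1]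
  constructor
  · rintro ⟨x, hx, rfl⟩
    simpa using (key x).1 hx
  · rintro ⟨hz, hl⟩
    exact ⟨firstCoords z, (key _).2 hz, by rw [← hl, pair_firstCoords]⟩

lemma lift_shrink_eq {D δ : ℝ} (hδ : δ < 1) :
    lift (shrink δ (Metric.closedBall (0 : Vec d) D)) =
      (fun x => pair x 1) '' Metric.closedBall (0 : Vec d) ((1 - δ) * D) := by
  ext z
  rw [mem_lift_shrink_iff hδ]
  constructor
  · rintro ⟨hz, hl⟩
    exact ⟨firstCoords z, by simpa using hz, by dsimp only; rw [← hl, pair_firstCoords]⟩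
  · rintro ⟨x, hx, rfl⟩
    simpa using hx

lemma continuous_pair (b : ℝ) : Continuous fun x : Vec d => pair x b := by
  unfold pair
  refine (PiLp.continuous_toLp 2 _).comp (continuous_pi fun i => ?_)
  induction i using Fin.lastCases
  · simpa using continuous_const
  · simp only [Fin.snoc_castSucc]
    fun_prop

lemma isCompact_lift_shrink {D δ : ℝ} (hδ : δ < 1) :
    IsCompact (lift (shrink δ (Metric.closedBall (0 : Vec d) D))) := by
  rw [lift_shrink_eq hδ]
  exact (isCompact_closedBall _ _).image (continuous_pair 1)

lemma convex_lift_shrink {D δ : ℝ} (hδ : δ < 1) :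
    Convex ℝ (lift (shrink δ (Metric.closedBall (0 : Vec d) D))) := by
  intro z hz w hw a b ha hb hab
  rw [mem_lift_shrink_iff hδ] at *
  constructor
  · rw [firstCoords_add, firstCoords_smul, firstCoords_smul]
    refine (norm_add_le _ _).trans ?_
    rw [norm_smul, norm_smul, Real.norm_of_nonneg ha, Real.norm_of_nonneg hb]
    calc _ ≤ a * ((1 - δ) * D) + b * ((1 - δ) * D) := by gcongr <;> tauto
      _ = (1 - δ) * D := by rw [← add_mul, hab, one_mul]
  · simp [hz.2, hw.2, hab]

lemma lift_shrink_subset {D δ : ℝ} (hD : 0 < D) (hδ0 : 0 < δ) (hδ : δ < 1) :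
    lift (shrink δ (Metric.closedBall (0 : Vec d) D)) ⊆
      interior (con (Metric.closedBall (0 : Vec d) D)) := by
  intro z hz
  rw [mem_lift_shrink_iff hδ] at hz
  refine mem_interior_con hD ?_
  rw [hz.2]
  nlinarith [hz.1]

/-- The local diameter of the shrunken lifted ball. -/
lemma localNorm_sub_le_of_mem_lift {ν D δ : ℝ} (hD : 0 < D) (hδ0 : 0 < δ) (hδ : δ ≤ 1 / 2)
    {R : Vec (d + 1) → ℝ} (hR : IsNormalBarrier (con (Metric.closedBall (0 : Vec d) D)) ν R)
    {x z : Vec (d + 1)} (hx : x ∈ lift (shrink δ (Metric.closedBall (0 : Vec d) D)))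
    (hz : z ∈ lift (shrink δ (Metric.closedBall (0 : Vec d) D))) :
    localNorm R x (z - x) ≤ 2 * (ν + 2 * √ν) * ((1 - δ) / δ) := by
  have hδ1 : δ < 1 := by linarith
  have hν := hR.one_le
  have hsν : 0 < √ν := Real.sqrt_pos.2 (by linarith)
  have hxi := lift_shrink_subset hD hδ0 hδ1 hx
  have hzi := lift_shrink_subset hD hδ0 hδ1 hz
  rcases le_total 0 (fderiv ℝ R x (z - x)) with h0 | h0
  · refine (hR.localNorm_sub_le hxi hzi h0).trans ?_
    have h1 : 1 ≤ (1 - δ) / δ := by rw [le_div_iff₀ hδ0]; linarith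
    nlinarith
  -- The gradient points away from `z`, so the segment is prolonged beyond `x` instead. The new
  -- point stays in the cone because `2 s (1 - δ) < δ`, and `s` is chosen so that `ν / s` is the
  -- claimed bound.
  · set s := δ / (2 * (1 - δ)) * (ν / (ν + 2 * √ν)) with hs
    have h1δ : 0 < 1 - δ := by linarith
    have hs0 : 0 < s := by positivity
    have hs1 : s < δ / (2 * (1 - δ)) := by
      have : ν / (ν + 2 * √ν) < 1 := by rw [div_lt_one (by positivity)]; linarith
      have h2 : 0 < δ / (2 * (1 - δ)) := by positivity
      nlinarith
    have hs2 : s * (2 * (1 - δ)) < δ := by rwa [lt_div_iff₀ (by positivity)] at hs1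
    rw [mem_lift_shrink_iff hδ1] at hx hz
    have hw : x + s • (x - z) ∈ interior (con (Metric.closedBall (0 : Vec d) D)) := by
      refine mem_interior_con hD ?_
      have e : (x + s • (x - z)) (Fin.last d) = 1 := by simp [hx.2, hz.2]
      rw [e, firstCoords_add, firstCoords_smul, firstCoords_sub, mul_one]
      calc _ ≤ ‖firstCoords x‖ + s * (‖firstCoords x‖ + ‖firstCoords z‖) := by
            refine (norm_add_le _ _).trans ?_
            rw [norm_smul, Real.norm_of_nonneg hs0.le]
            gcongr
            exact norm_sub_le _ _
        _ ≤ (1 - δ) * D + s * ((1 - δ) * D + (1 - δ) * D) := by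
            gcongr <;> tauto
        _ < D := by nlinarith
    have h2 : localNorm R x (x + s • (x - z) - x) ≤ ν := by
      refine hR.localNorm_sub_le hxi hw ?_
      have e : x + s • (x - z) - x = -(s • (z - x)) := by module
      rw [e, map_neg, map_smul, smul_eq_mul]
      nlinarith
    have e : x + s • (x - z) - x = (-s) • (z - x) := by module
    rw [e, localNorm_smul, abs_neg, abs_of_pos hs0] at h2
    have h3 : localNorm R x (z - x) ≤ ν / s := by rwa [le_div_iff₀ hs0, mul_comm]
    refine h3.trans (le_of_eq ?_)
    rw [hs]
    field_simp

/-- The oscillation of the barrier on the shrunken lifted ball. -/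
lemma sub_le_of_mem_lift {ν D δ : ℝ} (hD : 0 < D) (hδ0 : 0 < δ) (hδ : δ ≤ 1 / 2)
    {R : Vec (d + 1) → ℝ} (hR : IsNormalBarrier (con (Metric.closedBall (0 : Vec d) D)) ν R)
    {x z : Vec (d + 1)} (hx : x ∈ lift (shrink δ (Metric.closedBall (0 : Vec d) D)))
    (hz : z ∈ lift (shrink δ (Metric.closedBall (0 : Vec d) D))) :
    R z - R x ≤ 5 / 3 * (ν * Real.log (1 / δ)) := by
  have hδ1 : δ < 1 := by linarith
  have hxi := lift_shrink_subset hD hδ0 hδ1 hx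
  -- If `κ (2 - δ) < δ`, then `z` is `κ • x` plus an interior point, so `R z ≤ R (κ • x)`. The
  -- exponent `5/3` achieves this for `δ ≤ 1/2` and is what `etaParam_spec` leaves room for.
  set κ : ℝ := δ ^ (5 / 3 : ℝ) with hκ
  have hκ0 : 0 < κ := Real.rpow_pos_of_pos hδ0 _
  have hκ3 : κ ^ 3 = δ ^ 5 := by
    rw [hκ, ← Real.rpow_natCast, ← Real.rpow_mul hδ0.le, ← Real.rpow_natCast]
    norm_num
  have hκlt : κ * (2 - δ) < δ := by
    -- Cubing removes the fractional power and leaves `δ² (2 - δ)³ < 1`.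
    refine lt_of_pow_lt_pow_left₀ 3 hδ0.le ?_
    rw [mul_pow, hκ3]
    have h1 : δ ^ 2 * (2 - δ) ^ 3 < 1 := by
      have h2 : 0 ≤ δ ^ 3 * (1 / 2 - δ) := mul_nonneg (by positivity) (by linarith)
      have h3 : 0 < δ ^ 5 := by positivity
      nlinarith [sq_nonneg (δ - 1 / 2), mul_nonneg hδ0.le (sq_nonneg (δ - 1 / 2))]
    nlinarith [show 0 < δ ^ 3 by positivity]
  have hlast := (mem_lift_shrink_iff hδ1).1 hx
  have hlastz := (mem_lift_shrink_iff hδ1).1 hz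
  have hw : z - κ • x ∈ interior (con (Metric.closedBall (0 : Vec d) D)) := by
    refine mem_interior_con hD ?_
    have e : (z - κ • x) (Fin.last d) = 1 - κ := by simp [hlast.2, hlastz.2]
    rw [e, firstCoords_sub, firstCoords_smul]
    calc _ ≤ ‖firstCoords z‖ + κ * ‖firstCoords x‖ := by
          refine (norm_sub_le _ _).trans ?_
          rw [norm_smul, Real.norm_of_nonneg hκ0.le]
      _ ≤ (1 - δ) * D + κ * ((1 - δ) * D) := by
          gcongr <;> tauto
      _ < D * (1 - κ) := by nlinarith
  have h1 := hR.add_le (hR.smul_mem_interior hxi hκ0) hw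
  rw [add_sub_cancel, hR.log_homogeneous x hxi κ hκ0, hκ, Real.log_rpow hδ0] at h1
  rw [one_div, Real.log_inv]
  linarith

end Geometry

/-! ### Follow the regularized leader -/

/-- Applying `log v ≤ v - 1` to `v = (1 + a)(1 - r)` leaves `r + log (1 - r)`. The constant fits `r
≤ 1/4`, as `(1 - r)(1 + r + 4/3 r²) = 1 + 4/3 r² (1/4 - r)`. -/
lemma neg_sq_le_sub_log {a r : ℝ} (ha : 0 ≤ a) (hr : r ≤ 1 / 4) :
    -(4 / 3 * r ^ 2) ≤ a - Real.log (1 + a) - r * a := by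
  have h1 : 0 < 1 - r := by linarith
  have h2 : Real.log ((1 + a) * (1 - r)) ≤ (1 + a) * (1 - r) - 1 :=
    Real.log_le_sub_one_of_pos (by positivity)
  rw [Real.log_mul (by positivity) h1.ne'] at h2
  have h3 : 1 - (1 - r)⁻¹ ≤ Real.log (1 - r) := Real.one_sub_inv_le_log_of_pos h1
  have h4 : (1 - r)⁻¹ ≤ 1 + r + 4 / 3 * r ^ 2 := by
    rw [inv_le_iff_one_le_mul₀ h1]
    nlinarith [mul_nonneg (sq_nonneg r) (by linarith : (0 : ℝ) ≤ 1 / 4 - r)]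
  linarith

namespace IsNormalBarrier

variable {n : ℕ} {Ψ : Set (Vec n)} {ν : ℝ} {R : Vec n → ℝ}

/-- First-order optimality makes the linear term at the constrained minimizer nonnegative, leaving
the gain of `localNorm_sub_log_le`. -/
lemma sub_log_le_of_isMinOn (hR : IsNormalBarrier Ψ ν R) {S : Set (Vec n)} (hS : Convex ℝ S)
    (hSi : S ⊆ interior Ψ) {w x z : Vec n} (hx : x ∈ S) (hz : z ∈ S)
    (hmin : IsMinOn (fun z => inner ℝ w z + R z) S x) :
    localNorm R x (z - x) - Real.log (1 + localNorm R x (z - x)) ≤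
      (inner ℝ w z + R z) - (inner ℝ w x + R x) := by
  have hd : HasFDerivAt (fun z => inner ℝ w z + R z) (innerSL ℝ w + fderiv ℝ R x) x :=
    (innerSL ℝ w).hasFDerivAt.add (hR.hasFDerivAt (hSi hx))
  have h1 := hmin.localize.hasFDerivWithinAt_nonneg hd.hasFDerivWithinAt
    (sub_mem_posTangentConeAt_of_segment_subset (hS.segment_subset hx hz))
  have h2 := hR.localNorm_sub_log_le (hSi hx) (h := z - x) (by simpa using hSi hz)
  rw [add_sub_cancel] at h2
  simp only [add_apply, innerSL_apply_apply, inner_sub_right] at h1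
  linarith

/-- The regret bound of follow-the-regularized-leader with a self-concordant regularizer. -/
lemma ftrl_le (hR : IsNormalBarrier Ψ ν R) {S : Set (Vec n)} (hS : Convex ℝ S)
    (hSi : S ⊆ interior Ψ) {T : ℕ} {g x : ℕ → Vec n} {η r : ℝ} (hr : r ≤ 1 / 4)
    (hT : 0 < T) (hx : ∀ t < T, x t ∈ S)
    (hmin : ∀ t < T,
      IsMinOn (fun z => η * ∑ τ ∈ Finset.range t, inner ℝ (g τ) z + R z) S (x t))
    (hg : ∀ t < T, ∀ h, |η * inner ℝ (g t) h| ≤ r * localNorm R (x t) h) {z : Vec n}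
    (hz : z ∈ S) :
    η * ∑ τ ∈ Finset.range T, inner ℝ (g τ) (x τ - z) ≤ R z - R (x 0) + T * (4 / 3 * r ^ 2) := by
  -- A lower bound on the objective at every point of `S`, applied inductively at `x t`. Moving on
  -- to `z` gains `a - log (1 + a)` and the new loss takes back at most `r a`, so a round loses at
  -- most `4/3 r²`; successive iterates are never compared.
  have key : ∀ t ≤ T, ∀ z ∈ S,
      R (x 0) + η * ∑ τ ∈ Finset.range t, inner ℝ (g τ) (x τ) - t * (4 / 3 * r ^ 2) ≤
        η * ∑ τ ∈ Finset.range t, inner ℝ (g τ) z + R z := by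
    intro t
    induction t with
    | zero =>
      intro _ z hz
      simpa using hmin 0 hT hz
    | succ t ih =>
      intro ht z hz
      have htT : t < T := ht
      have e : ∀ z, η * ∑ τ ∈ Finset.range t, inner ℝ (g τ) z =
          inner ℝ (η • ∑ τ ∈ Finset.range t, g τ) z := by
        intro z
        rw [real_inner_smul_left, sum_inner]
      have h1 := ih htT.le (x t) (hx t htT)
      have hm := hmin t htT
      simp only [e] at hm
      have h2 := hR.sub_log_le_of_isMinOn hS hSi (hx t htT) hz hm
      rw [← e, ← e] at h2
      have h3 := (abs_le.1 (hg t htT (z - x t))).1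
      have h4 := neg_sq_le_sub_log (localNorm_nonneg R (x t) (z - x t)) hr
      rw [inner_sub_right] at h3
      rw [Finset.sum_range_succ, Finset.sum_range_succ]
      push_cast
      linarith
  have h := key T le_rfl z hz
  simp only [inner_sub_right, Finset.sum_sub_distrib]
  linarith

end IsNormalBarrier

/-! ### Uniform draws from the sphere of a predictable hyperplane -/

section UniformDraw

variable {Ω β : Type*} [mΩ : MeasurableSpace Ω] {mβ : MeasurableSpace β}
  {P : Measure Ω} [IsProbabilityMeasure P] {d : ℕ} {X : Ω → β} {Y : Ω → Vec (d + 1)}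
  {v : β → Vec (d + 1)}

lemma ae_norm_eq_one_of_uniformPerp (hd : 1 ≤ d) (hX : Measurable X) (hY : Measurable Y)
    (hv : Measurable v) (hv0 : ∀ b, v b ≠ 0)
    (h : ∀ B : Set (Vec (d + 1)), MeasurableSet B →
      P[(Y ⁻¹' B).indicator (fun _ => (1 : ℝ)) | mβ.comap X] =ᵐ[P]
        fun ω => (uniformPerp (v (X ω))).real B) :
    ∀ᵐ ω ∂P, ‖Y ω‖ = 1 ∧ inner ℝ (v (X ω)) (Y ω) = 0 := by
  have hκ : ∀ ω, IsProbabilityMeasure (uniformPerp (v (X ω))) := fun ω =>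
    isProbabilityMeasure_uniformPerp hd (hv0 _)
  refine ae_of_condExp_indicator hX hY hκ h
    (p := fun z : β × Vec (d + 1) => ‖z.2‖ = 1 ∧ inner ℝ (v z.1) z.2 = 0) ?_ fun ω => ?_
  · exact (measurableSet_eq_fun (by fun_prop) (by fun_prop)).inter
      (measurableSet_eq_fun ((hv.comp measurable_fst).inner measurable_snd) (by fun_prop))
  · have h1 := uniformPerp_real_compl (v (X ω))
    have := hκ ω
    rwa [measureReal_eq_zero_iff] at h1

/-- The conditional expectation of the one-point gradient estimate, in integrated form. -/
lemma integral_estimate_eq_zero (hd : 1 ≤ d) (hX : Measurable X) (hY : Measurable Y)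
    (hv : Measurable v) (hv0 : ∀ b, v b ≠ 0)
    (h : ∀ B : Set (Vec (d + 1)), MeasurableSet B →
      P[(Y ⁻¹' B).indicator (fun _ => (1 : ℝ)) | mβ.comap X] =ᵐ[P]
        fun ω => (uniformPerp (v (X ω))).real B)
    {a b : β → Vec (d + 1)} {c : β → ℝ} (ha : Measurable a) (hb : Measurable b)
    (hc : Measurable c) (hvb : ∀ x, inner ℝ (v x) (b x) = 0) {C : ℝ} (haC : ∀ x, ‖a x‖ ≤ C)
    (hbC : ∀ x, ‖b x‖ ≤ C) (hcC : ∀ x, |c x| ≤ C) :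
    Integrable (fun ω => d * (c (X ω) + inner ℝ (a (X ω)) (Y ω)) * inner ℝ (b (X ω)) (Y ω) -
        (inner ℝ (a (X ω)) (b (X ω)) + inner ℝ (a (X ω)) (Y ω))) P ∧
      ∫ ω, (d * (c (X ω) + inner ℝ (a (X ω)) (Y ω)) * inner ℝ (b (X ω)) (Y ω) -
        (inner ℝ (a (X ω)) (b (X ω)) + inner ℝ (a (X ω)) (Y ω))) ∂P = 0 := by
  set Φ : β × Vec (d + 1) → ℝ := fun z =>
    d * (c z.1 + inner ℝ (a z.1) z.2) * inner ℝ (b z.1) z.2 -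
      (inner ℝ (a z.1) (b z.1) + inner ℝ (a z.1) z.2) with hΦ
  have h1 : Measurable fun z : β × Vec (d + 1) => inner ℝ (a z.1) z.2 :=
    (ha.comp measurable_fst).inner measurable_snd
  have h2 : Measurable fun z : β × Vec (d + 1) => inner ℝ (b z.1) z.2 :=
    (hb.comp measurable_fst).inner measurable_snd
  have h3 : Measurable fun z : β × Vec (d + 1) => inner ℝ (a z.1) (b z.1) :=
    (ha.inner hb).comp measurable_fst
  have h4 : Measurable fun z : β × Vec (d + 1) => c z.1 := hc.comp measurable_fst
  have hΦm : Measurable Φ := ((((h4.add h1).const_mul _).mul h2).sub (h3.add h1))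
  have hint : Integrable (fun ω => Φ (X ω, Y ω)) P := by
    refine Integrable.of_bound (hΦm.comp (hX.prodMk hY)).aestronglyMeasurable
      (d * (C + C) * C + (C * C + C)) ?_
    filter_upwards [ae_norm_eq_one_of_uniformPerp hd hX hY hv hv0 h] with ω hω
    have hC : 0 ≤ C := (norm_nonneg _).trans (haC (X ω))
    have e1 : |inner ℝ (a (X ω)) (Y ω)| ≤ C := by
      refine (abs_real_inner_le_norm _ _).trans ?_
      rw [hω.1, mul_one]; exact haC _
    have e2 : |inner ℝ (b (X ω)) (Y ω)| ≤ C := by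
      refine (abs_real_inner_le_norm _ _).trans ?_
      rw [hω.1, mul_one]; exact hbC _
    have e3 : |inner ℝ (a (X ω)) (b (X ω))| ≤ C * C :=
      (abs_real_inner_le_norm _ _).trans
        (mul_le_mul (haC _) (hbC _) (norm_nonneg _) hC)
    rw [Real.norm_eq_abs]
    refine (abs_sub _ _).trans (add_le_add ?_ ((abs_add_le _ _).trans (add_le_add e3 e1)))
    rw [abs_mul, abs_mul, Nat.abs_cast]
    gcongr
    exact (abs_add_le _ _).trans (add_le_add (hcC _) e1)
  refine ⟨hint, integral_eq_zero_of_condExp_indicator hX hY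
    (fun ω => isProbabilityMeasure_uniformPerp hd (hv0 _)) h hΦm hint fun ω => ?_⟩
  have hd0 : (d : ℝ) ≠ 0 := by positivity
  set x := X ω
  have := isProbabilityMeasure_uniformPerp hd (hv0 x)
  have i1 : Integrable (fun y => inner ℝ (a x) y) (uniformPerp (v x)) :=
    integrable_uniformPerp hd (hv0 x) (by fun_prop)
  have i2 : Integrable (fun y => inner ℝ (b x) y) (uniformPerp (v x)) :=
    integrable_uniformPerp hd (hv0 x) (by fun_prop)
  have i3 : Integrable (fun y => inner ℝ (a x) y * inner ℝ (b x) y) (uniformPerp (v x)) :=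
    integrable_uniformPerp hd (hv0 x) (by fun_prop)
  have e : ∀ y, Φ (x, y) = (d * c x) * inner ℝ (b x) y +
      d * (inner ℝ (a x) y * inner ℝ (b x) y) - (inner ℝ (a x) (b x) + inner ℝ (a x) y) := by
    intro y; simp only [hΦ]; ring
  simp only [e]
  have j1 : Integrable (fun y => (d * c x) * inner ℝ (b x) y +
      d * (inner ℝ (a x) y * inner ℝ (b x) y)) (uniformPerp (v x)) :=
    (i2.const_mul _).add (i3.const_mul _)
  have j2 : Integrable (fun y => inner ℝ (a x) (b x) + inner ℝ (a x) y) (uniformPerp (v x)) :=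
    (integrable_const _).add i1
  -- The terms linear in `y` have mean zero; the quadratic one contributes `⟨a, b⟩` because `b x` is
  -- orthogonal to `v x`.
  rw [integral_sub j1 j2, integral_add (i2.const_mul _) (i3.const_mul _),
    integral_add (integrable_const _) i1,
    integral_const_mul, integral_const_mul, integral_inner_uniformPerp,
    integral_inner_uniformPerp, integral_inner_mul_inner_uniformPerp hd (hv0 x) _ (hvb x),
    integral_const]
  simp only [probReal_univ, smul_eq_mul]
  field_simp
  ring

end UniformDraw

/-! ### Measurability and continuity of functions of the iterate -/

lemma measurable_comp_of_continuousOn {Ω V W : Type*} {m : MeasurableSpace Ω} [TopologicalSpace V]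
    [MeasurableSpace V] [BorelSpace V] [TopologicalSpace W] [MeasurableSpace W] [BorelSpace W]
    {S : Set V} {g : V → W} (hg : ContinuousOn g S) {x : Ω → V} (hx : Measurable x)
    (hmem : ∀ ω, x ω ∈ S) : Measurable fun ω => g (x ω) :=
  (continuousOn_iff_continuous_domRestrict.1 hg).measurable.comp (hx.subtype_mk (h := hmem))

lemma continuousOn_mulVecE {n : ℕ} {S : Set (Vec n)} {A : Vec n → Matrix (Fin n) (Fin n) ℝ}
    {w : Vec n → Vec n} (hA : ContinuousOn A S) (hw : ContinuousOn w S) :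
    ContinuousOn (fun x => mulVecE (A x) (w x)) S := by
  unfold mulVecE
  refine (PiLp.continuous_toLp 2 _).comp_continuousOn ?_
  refine continuousOn_iff_continuous_domRestrict.2 ?_
  exact (continuousOn_iff_continuous_domRestrict.1 hA).matrix_mulVec
    ((PiLp.continuous_ofLp 2 _).comp (continuousOn_iff_continuous_domRestrict.1 hw))

/-! ### Geometry of a round -/

section Round

variable {d : ℕ} {ν D : ℝ} {R : Vec (d + 1) → ℝ} {x u : Vec (d + 1)}

lemma inner_scaling_inv {n : ℕ} (R : Vec n → ℝ) (x u h : Vec n) :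
    inner ℝ (mulVecE (scaling R x)⁻¹ u) h = inner ℝ (mulVecE (scaling R x)⁻¹ h) u := by
  rw [inner_mulVecE_comm (scaling_inv_transpose R x), real_inner_comm]

lemma inner_estimator (f : Vec d → ℝ) (h : Vec (d + 1)) :
    inner ℝ (estimator R f x u) h =
      d * f (play R x u) * inner ℝ (mulVecE (scaling R x)⁻¹ h) u := by
  rw [estimator, real_inner_smul_left, inner_scaling_inv]

lemma inner_play (θ : Vec d) :
    inner ℝ θ (play R x u) =
      inner ℝ (pair θ 0) x + inner ℝ (mulVecE (scaling R x) (pair θ 0)) u := by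
  rw [play, inner_firstCoords, inner_add_right, inner_mulVecE_comm (scaling_transpose R x)]

namespace IsNormalBarrier

lemma scaling_single_ne_zero {n : ℕ} {Ψ : Set (Vec n)} {R : Vec n → ℝ}
    (hR : IsNormalBarrier Ψ ν R) {x : Vec n} (hx : x ∈ interior Ψ) (i : Fin n) :
    mulVecE (scaling R x) (EuclideanSpace.single i 1) ≠ 0 := by
  intro h0
  have h1 : mulVecE (scaling R x)⁻¹ (mulVecE (scaling R x) (EuclideanSpace.single i 1)) = 0 := by
    rw [h0]; simp [mulVecE]
  rw [mulVecE_mulVecE, hR.scaling_inv_mul hx, mulVecE_one] at h1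
  simpa using congrArg (fun z : Vec n => z i) h1

/-- The point is a limit of points of the open Dikin ellipsoid, and the cone is closed. -/
lemma add_scaling_mem {n : ℕ} {Ψ : Set (Vec n)} {R : Vec n → ℝ}
    (hR : IsNormalBarrier Ψ ν R) {x u : Vec n} (hx : x ∈ interior Ψ) (hu : ‖u‖ ≤ 1) :
    x + mulVecE (scaling R x) u ∈ Ψ := by
  have h1 : ∀ s ∈ Set.Ico (0 : ℝ) 1, x + s • mulVecE (scaling R x) u ∈ Ψ := by
    intro s hs
    refine interior_subset (hR.add_mem_interior hx ?_)
    rw [localNorm_smul, hR.localNorm_scaling hx, abs_of_nonneg hs.1]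
    nlinarith [hs.1, hs.2, norm_nonneg u]
  have hcont : Continuous fun s : ℝ => x + s • mulVecE (scaling R x) u := by fun_prop
  have h2 : x + (1 : ℝ) • mulVecE (scaling R x) u ∈ Ψ := by
    refine hR.cone.isClosed.mem_of_tendsto
      ((hcont.tendsto 1).mono_left (nhdsWithin_le_nhds (s := Set.Iio 1))) ?_
    filter_upwards [Ioo_mem_nhdsLT (zero_lt_one' ℝ)] with s hs
    exact h1 s ⟨hs.1.le, hs.2⟩
  simpa using h2

/-- Orthogonality to `A e_{d+1}` means that `A u` has last coordinate `0`, so the step stays at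
height `1`. -/
lemma norm_play_le (hR : IsNormalBarrier (con (Metric.closedBall (0 : Vec d) D)) ν R)
    (hx : x ∈ interior (con (Metric.closedBall (0 : Vec d) D))) (hlast : x (Fin.last d) = 1)
    (hu : ‖u‖ = 1)
    (hperp : inner ℝ (mulVecE (scaling R x) (EuclideanSpace.single (Fin.last d) 1)) u = 0) :
    ‖play R x u‖ ≤ D := by
  refine norm_firstCoords_le_of_mem_con (hR.add_scaling_mem hx hu.le) ?_
  rw [inner_mulVecE_comm (scaling_transpose R x)] at hperp
  have h1 : mulVecE (scaling R x) u (Fin.last d) = 0 := by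
    simpa [EuclideanSpace.inner_single_left] using hperp
  simp [hlast, h1]

lemma abs_inner_scaling_inv_le {n : ℕ} {Ψ : Set (Vec n)} {R : Vec n → ℝ}
    (hR : IsNormalBarrier Ψ ν R) {x u : Vec n} (hx : x ∈ interior Ψ) (hu : ‖u‖ = 1)
    (h : Vec n) : |inner ℝ (mulVecE (scaling R x)⁻¹ h) u| ≤ localNorm R x h := by
  refine (abs_real_inner_le_norm _ _).trans ?_
  rw [hR.norm_scaling_inv hx, hu, mul_one]

end IsNormalBarrier

end Round

/-! ### Arithmetic of the regret bound -/

section Bound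

variable {d T : ℕ} {ν G D ε δ : ℝ}

lemma regretBound_terms_nonneg (hν : 1 ≤ ν) (hG : 0 ≤ G) (hD : 0 ≤ D) (hε : 0 ≤ ε) (hδ0 : 0 < δ)
    (hδ1 : δ < 1) :
    0 ≤ 4 * d * √(ν * T * Real.log (1 / δ)) ∧
      0 ≤ 2 * d * T * (ν + 2 * √ν) * ((1 - δ) / δ) * ε ∧ 0 ≤ δ * G * D * T ∧ 0 ≤ 2 * T * ε := by
  have h1 : 0 ≤ 1 - δ := by linarith
  refine ⟨by positivity, by positivity, by positivity, by positivity⟩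

/-- The two terms with the factor `ε = δ²` suffice: their sum exceeds `2T` by at least `2T (2δ -
1)(1 - δ)`. -/
lemma two_mul_le_regretBound_of_half_le (hd : 1 ≤ d) (hν : 1 ≤ ν) (hG : 0 ≤ G) (hD : 0 ≤ D)
    (hδ : 1 / 2 ≤ δ) (hδ1 : δ < 1) (hε : ε = δ ^ 2) : 2 * T ≤ regretBound d T ν G D ε δ := by
  have hδ0 : 0 < δ := by linarith
  obtain ⟨h1, -, h3, -⟩ := regretBound_terms_nonneg (d := d) (T := T) (ε := ε) hν hG hD
    (by rw [hε]; positivity) hδ0 hδ1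
  have hd' : (1 : ℝ) ≤ d := by exact_mod_cast hd
  have hT0 : (0 : ℝ) ≤ T := by positivity
  have hsν : 1 ≤ √ν := Real.one_le_sqrt.2 hν
  have h4 : 6 * (T * ((1 - δ) * δ)) ≤ 2 * d * T * (ν + 2 * √ν) * ((1 - δ) / δ) * ε := by
    have e : 2 * d * T * (ν + 2 * √ν) * ((1 - δ) / δ) * ε =
        (2 * (d * (ν + 2 * √ν))) * (T * ((1 - δ) * δ)) := by
      rw [hε]; field_simp
    rw [e]
    have h5 : 0 ≤ (1 - δ) * δ := mul_nonneg (by linarith) hδ0.le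
    refine mul_le_mul_of_nonneg_right ?_ (by positivity)
    nlinarith
  have h6 : 2 * T ≤ 6 * (T * ((1 - δ) * δ)) + 2 * T * ε := by
    rw [hε]
    have : (0 : ℝ) ≤ T * ((2 * δ - 1) * (1 - δ)) :=
      mul_nonneg hT0 (mul_nonneg (by linarith) (by linarith))
    nlinarith
  unfold regretBound
  linarith

/-- For such `T` the first term alone is at least `2T`. -/
lemma two_mul_le_regretBound_of_le (hd : 1 ≤ d) (hν : 1 ≤ ν) (hG : 0 ≤ G) (hD : 0 ≤ D)
    (hε : 0 ≤ ε) (hδ0 : 0 < δ) (hδ1 : δ < 1)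
    (hT : (T : ℝ) ≤ 4 * d ^ 2 * (ν * Real.log (1 / δ))) :
    2 * T ≤ regretBound d T ν G D ε δ := by
  obtain ⟨-, h2, h3, h4⟩ := regretBound_terms_nonneg (d := d) (T := T) hν hG hD hε hδ0 hδ1
  have hd' : (0 : ℝ) < d := by exact_mod_cast hd
  have h5 : (T : ℝ) / (2 * d) ≤ √(ν * T * Real.log (1 / δ)) := by
    refine Real.le_sqrt_of_sq_le ?_
    rw [div_pow, div_le_iff₀ (by positivity)]
    nlinarith [mul_le_mul_of_nonneg_left hT (Nat.cast_nonneg T)]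
  rw [div_le_iff₀ (by positivity)] at h5
  unfold regretBound
  linarith

/-- With `L = log (1 / δ)`, `η d = √(ν L) / (2 √T)`, so the quadratic term is `ν L / 3` and both
sides equal `2 ν L`. The lower bound on `T` gives `η d ≤ 1/4`, as `ftrl_le` requires. -/
lemma etaParam_spec (hd : 1 ≤ d) (hT1 : 1 ≤ T) (hν : 1 ≤ ν) (hδ0 : 0 < δ) (hδ1 : δ < 1)
    (hT : 4 * d ^ 2 * (ν * Real.log (1 / δ)) < T) :
    0 < etaParam d T ν δ ∧ etaParam d T ν δ * d ≤ 1 / 4 ∧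
      5 / 3 * (ν * Real.log (1 / δ)) + T * (4 / 3 * (etaParam d T ν δ * d) ^ 2) =
        etaParam d T ν δ * (4 * d * √(ν * T * Real.log (1 / δ))) := by
  have hd0 : (1 : ℝ) ≤ d := by exact_mod_cast hd
  have hT0 : (0 : ℝ) < T := by exact_mod_cast hT1
  have hL : 0 < Real.log (1 / δ) := Real.log_pos (by rw [lt_div_iff₀ hδ0]; linarith)
  have hνL : 0 < ν * Real.log (1 / δ) := by positivity
  have e : √(ν * T * Real.log (1 / δ)) = √(ν * Real.log (1 / δ)) * √T := by
    rw [← Real.sqrt_mul hνL.le]; congr 1; ring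
  have hs := Real.sqrt_pos.2 hνL
  have hq := Real.sqrt_pos.2 hT0
  have hs2 := Real.sq_sqrt hνL.le
  have hq2 := Real.sq_sqrt hT0.le
  unfold etaParam
  rw [e]
  set s := √(ν * Real.log (1 / δ))
  set q := √(T : ℝ)
  rw [← hs2, ← hq2] at hT
  rw [← hs2, ← hq2]
  have hsq : 2 * d * s < q := lt_of_pow_lt_pow_left₀ 2 hq.le (by nlinarith)
  refine ⟨by positivity, ?_, ?_⟩
  · rw [div_mul_eq_mul_div, div_le_div_iff₀ (by positivity) (by norm_num)]
    nlinarith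
  · field_simp
    ring

lemma regretBound_order (ν G D : ℝ) :
    ∃ C : ℝ, ∀ (d T : ℕ) (ε δ : ℝ), 1 ≤ d → 1 ≤ T → 0 ≤ ε → δ = deltaParam T ε → δ < 1 →
      regretBound d T ν G D ε δ
        ≤ C * (√(Real.log (1 / δ)) * (d * √T) + √ε * d * T + ε * d * T) := by
  refine ⟨4 * √ν + 2 * (|ν| + 2 * √ν) + |G * D| + 2, ?_⟩
  intro d T ε δ hd hT hε hδ hδ1
  have hd' : (1 : ℝ) ≤ d := by exact_mod_cast hd
  have hT' : (1 : ℝ) ≤ T := by exact_mod_cast hT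
  have hqT : 1 ≤ √(T : ℝ) := Real.one_le_sqrt.2 hT'
  set A := √(Real.log (1 / δ)) * (d * √T) with hA
  have hA0 : 0 ≤ A := by positivity
  have hB0 : 0 ≤ √ε * d * T := by positivity
  have hE0 : 0 ≤ ε * d * T := by positivity
  have hsν : 0 ≤ √ν := Real.sqrt_nonneg _
  have hδ0 : 0 < δ := by
    rw [hδ, deltaParam]
    split_ifs with h
    · positivity
    · exact Real.sqrt_pos.2 (lt_of_le_of_ne hε (Ne.symm h))
  have h1 : 4 * d * √(ν * T * Real.log (1 / δ)) = 4 * √ν * A := by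
    have hL : 0 ≤ Real.log (1 / δ) := Real.log_nonneg (by rw [le_div_iff₀ hδ0]; linarith)
    rw [Real.sqrt_mul' _ hL, Real.sqrt_mul' _ (by positivity : (0 : ℝ) ≤ T), hA]
    ring
  have h4 : 2 * T * ε ≤ 2 * (ε * d * T) := by nlinarith [mul_nonneg hε (by positivity : (0:ℝ) ≤ T)]
  have h2 : 2 * d * T * (ν + 2 * √ν) * ((1 - δ) / δ) * ε ≤
      2 * (|ν| + 2 * √ν) * (√ε * d * T) := by
    have h5 : 0 ≤ (1 - δ) / δ * ε := mul_nonneg (div_nonneg (by linarith) hδ0.le) hε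
    have h6 : (1 - δ) / δ * ε ≤ √ε := by
      by_cases h : ε = 0
      · simp [h]
      · have e : δ = √ε := by rw [hδ, deltaParam, if_neg h]
        have e2 : ε = δ ^ 2 := by rw [e, Real.sq_sqrt hε]
        rw [← e, e2]
        have : (1 - δ) / δ * δ ^ 2 = (1 - δ) * δ := by field_simp
        rw [this]
        nlinarith
    calc _ = 2 * (ν + 2 * √ν) * (d * T * ((1 - δ) / δ * ε)) := by ring
      _ ≤ 2 * (|ν| + 2 * √ν) * (d * T * ((1 - δ) / δ * ε)) := by
          gcongr; exact le_abs_self ν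
      _ ≤ 2 * (|ν| + 2 * √ν) * (d * T * √ε) := by gcongr
      _ = _ := by ring
  have h3 : δ * G * D * T ≤ |G * D| * (A + √ε * d * T) := by
    have h7 : δ * G * D * T ≤ |G * D| * (δ * T) := by
      have := mul_le_mul_of_nonneg_right (le_abs_self (G * D))
        (by positivity : 0 ≤ δ * (T : ℝ))
      linarith
    refine h7.trans (mul_le_mul_of_nonneg_left ?_ (abs_nonneg _))
    by_cases h : ε = 0
    · have e : δ = 1 / (T : ℝ) ^ 2 := by rw [hδ, deltaParam, if_pos h]
      -- `δ < 1` excludes `T = 1`. Then `log (1 / δ) ≥ 2 log 2 > 1`, hence `A ≥ 1 ≥ T δ`.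
      have hT2 : (2 : ℝ) ≤ T := by
        have : T ≠ 1 := by
          rintro rfl
          rw [e] at hδ1
          norm_num at hδ1
        exact_mod_cast (show 2 ≤ T by omega)
      have hL : 1 ≤ Real.log (1 / δ) := by
        rw [e, one_div_one_div, Real.log_pow]
        have h8 := Real.log_le_log two_pos hT2
        have h9 := Real.log_two_gt_d9
        push_cast
        linarith
      have hsL : 1 ≤ √(Real.log (1 / δ)) := Real.one_le_sqrt.2 hL
      have h10 : δ * T ≤ 1 := by
        rw [e, div_mul_eq_mul_div, div_le_one (by positivity)]
        nlinarith
      have h11 : 1 ≤ A := by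
        rw [hA]
        exact one_le_mul_of_one_le_of_one_le hsL (one_le_mul_of_one_le_of_one_le hd' hqT)
      linarith
    · have e : δ = √ε := by rw [hδ, deltaParam, if_neg h]
      rw [← e]
      have : δ * T * 1 ≤ δ * T * d := mul_le_mul_of_nonneg_left hd' (by positivity)
      linarith
  unfold regretBound
  rw [h1]
  have hν0 := abs_nonneg ν
  have hGD := abs_nonneg (G * D)
  nlinarith [mul_nonneg hsν hA0, mul_nonneg hsν hB0, mul_nonneg hsν hE0, mul_nonneg hν0 hA0,
    mul_nonneg hν0 hB0, mul_nonneg hν0 hE0, mul_nonneg hGD hA0, mul_nonneg hGD hB0,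
    mul_nonneg hGD hE0]

end Bound

/-! ### The regret of a fixed sequence of draws -/

section Pathwise

variable {d T : ℕ} {ν G D ε δ : ℝ}

/-- The minimizer of a linear functional over the ball of radius `(1 - δ) D`. -/
def linearMinimizer (D δ : ℝ) (Θ : Vec d) : Vec d := (-((1 - δ) * D / ‖Θ‖)) • Θ

lemma norm_linearMinimizer_le (hD : 0 ≤ D) (hδ1 : δ ≤ 1) (Θ : Vec d) :
    ‖linearMinimizer D δ Θ‖ ≤ (1 - δ) * D := by
  have h : 0 ≤ (1 - δ) * D := mul_nonneg (by linarith) hD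
  rw [linearMinimizer, norm_smul, norm_neg, Real.norm_of_nonneg (by positivity)]
  rcases eq_or_ne ‖Θ‖ 0 with h0 | h0
  · simpa [h0] using h
  · rw [div_mul_cancel₀ _ h0]

lemma inner_linearMinimizer (Θ : Vec d) :
    inner ℝ Θ (linearMinimizer D δ Θ) = -((1 - δ) * D * ‖Θ‖) := by
  rw [linearMinimizer, real_inner_smul_right, real_inner_self_eq_norm_sq]
  rcases eq_or_ne ‖Θ‖ 0 with h | h
  · simp [h]
  · field_simp

lemma abs_sum_le_card {f : ℕ → ℝ} (hf : ∀ t < T, |f t| ≤ 1) :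
    |∑ t ∈ Finset.range T, f t| ≤ T := by
  refine (Finset.abs_sum_le_sum_abs _ _).trans ?_
  refine (Finset.sum_le_sum fun t ht => hf t (Finset.mem_range.1 ht)).trans ?_
  simp

lemma abs_iInf_sum_le (hD : 0 ≤ D) {f : ℕ → Vec d → ℝ}
    (hf : ∀ t < T, ∀ x ∈ Metric.closedBall (0 : Vec d) D, |f t x| ≤ 1) :
    |⨅ x : Metric.closedBall (0 : Vec d) D, ∑ t ∈ Finset.range T, f t x| ≤ T := by
  have : Nonempty (Metric.closedBall (0 : Vec d) D) := ⟨⟨0, by simpa using hD⟩⟩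
  have hb : ∀ x : Metric.closedBall (0 : Vec d) D, |∑ t ∈ Finset.range T, f t x| ≤ T := fun x =>
    abs_sum_le_card fun t ht => hf t ht x x.2
  refine abs_le.2 ⟨le_ciInf fun x => (abs_le.1 (hb x)).1, ?_⟩
  exact (ciInf_le ⟨-(T : ℝ), by rintro _ ⟨x, rfl⟩; exact (abs_le.1 (hb x)).1⟩
    (Classical.arbitrary _)).trans (abs_le.1 (hb _)).2

/-- Over the full ball the linear part is at least `-D ‖Θ‖`, and the comparator attains `-(1 - δ) D
‖Θ‖` with `‖Θ‖ ≤ T G`. Linearizing the plays and the infimum costs `T ε` each. -/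
lemma regret_le_linear (hD : 0 ≤ D) (hδ0 : 0 ≤ δ) {f : ℕ → Vec d → ℝ}
    {θ y : ℕ → Vec d} (hθ : ∀ t < T, ‖θ t‖ ≤ G)
    (hf : ∀ t < T, IsApproxLinear (Metric.closedBall (0 : Vec d) D) ε (θ t) (f t))
    (hy : ∀ t < T, ‖y t‖ ≤ D) :
    regret (Metric.closedBall (0 : Vec d) D) T f y ≤
      ∑ t ∈ Finset.range T,
          inner ℝ (θ t) (y t - linearMinimizer D δ (∑ t ∈ Finset.range T, θ t)) +
        δ * G * D * T + 2 * T * ε := by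
  set Θ := ∑ t ∈ Finset.range T, θ t with hΘ
  have : Nonempty (Metric.closedBall (0 : Vec d) D) := ⟨⟨0, by simpa using hD⟩⟩
  have h1 : ∑ t ∈ Finset.range T, f t (y t) ≤ ∑ t ∈ Finset.range T, inner ℝ (θ t) (y t) + T * ε := by
    have : ∑ t ∈ Finset.range T, f t (y t) ≤ ∑ t ∈ Finset.range T, (inner ℝ (θ t) (y t) + ε) := by
      refine Finset.sum_le_sum fun t ht => ?_
      have := (abs_le.1 (hf t (Finset.mem_range.1 ht) (y t)
        (by simpa using hy t (Finset.mem_range.1 ht)))).2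
      linarith
    simpa [Finset.sum_add_distrib] using this
  have h2 : -(D * ‖Θ‖) - T * ε ≤
      ⨅ x : Metric.closedBall (0 : Vec d) D, ∑ t ∈ Finset.range T, f t x := by
    refine le_ciInf fun x => ?_
    have h3 : ∑ t ∈ Finset.range T, (inner ℝ (θ t) (x : Vec d) - ε) ≤
        ∑ t ∈ Finset.range T, f t x := by
      refine Finset.sum_le_sum fun t ht => ?_
      have := (abs_le.1 (hf t (Finset.mem_range.1 ht) x x.2)).1
      linarith
    rw [Finset.sum_sub_distrib, ← sum_inner, ← hΘ] at h3
    simp only [Finset.sum_const, Finset.card_range, nsmul_eq_mul] at h3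
    have h4 := (abs_le.1 (abs_real_inner_le_norm Θ (x : Vec d))).1
    have h5 : ‖(x : Vec d)‖ ≤ D := mem_closedBall_zero_iff.1 x.2
    nlinarith [norm_nonneg Θ]
  have h6 : ∑ t ∈ Finset.range T, inner ℝ (θ t) (y t - linearMinimizer D δ Θ) =
      ∑ t ∈ Finset.range T, inner ℝ (θ t) (y t) + (1 - δ) * D * ‖Θ‖ := by
    simp only [inner_sub_right, Finset.sum_sub_distrib]
    rw [← sum_inner, ← hΘ, inner_linearMinimizer]
    ring
  have h7 : ‖Θ‖ ≤ T * G := by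
    refine (norm_sum_le _ _).trans ?_
    refine (Finset.sum_le_sum fun t ht => hθ t (Finset.mem_range.1 ht)).trans ?_
    simp
  have h8 : δ * D * ‖Θ‖ ≤ δ * D * (T * G) := mul_le_mul_of_nonneg_left h7 (by positivity)
  rw [regret, h6]
  linarith

/-- The deviation of the linear loss of a round from its estimate; it has mean zero. -/
def roundError (R : Vec (d + 1) → ℝ) (θ : Vec d) (z x u : Vec (d + 1)) : ℝ :=
  d * (inner ℝ (pair θ 0) x + inner ℝ (mulVecE (scaling R x) (pair θ 0)) u) *
      inner ℝ (mulVecE (scaling R x)⁻¹ (x - z)) u -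
    (inner ℝ (mulVecE (scaling R x) (pair θ 0)) (mulVecE (scaling R x)⁻¹ (x - z)) +
      inner ℝ (mulVecE (scaling R x) (pair θ 0)) u)

/-- Split the observed loss into its linear part, which produces `roundError`, and the perturbation.
The latter may depend on `u`, so it is bounded by Cauchy–Schwarz instead of being averaged. -/
lemma inner_sub_le_estimator {Ψ : Set (Vec (d + 1))} {R : Vec (d + 1) → ℝ}
    (hR : IsNormalBarrier Ψ ν R) {x u : Vec (d + 1)} (hx : x ∈ interior Ψ) (hu : ‖u‖ = 1)
    {f : Vec d → ℝ} {θ : Vec d} (hε : 0 ≤ ε) (hf : |f (play R x u) - inner ℝ θ (play R x u)| ≤ ε)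
    (w : Vec d) {B : ℝ} (hB : localNorm R x (x - pair w 1) ≤ B) :
    inner ℝ θ (play R x u - w) ≤
      inner ℝ (estimator R f x u) (x - pair w 1) + d * ε * B - roundError R θ (pair w 1) x u := by
  have e1 : inner ℝ (mulVecE (scaling R x) (pair θ 0)) (mulVecE (scaling R x)⁻¹ (x - pair w 1)) =
      inner ℝ (pair θ 0) x - inner ℝ θ w := by
    rw [inner_mulVecE_comm (scaling_transpose R x), mulVecE_mulVecE, hR.scaling_mul_inv hx,
      mulVecE_one, inner_sub_right, ← inner_firstCoords, ← inner_firstCoords, firstCoords_pair]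
  rw [roundError, e1, ← inner_play, inner_estimator, inner_sub_right]
  have h1 := (hR.abs_inner_scaling_inv_le hx hu (x - pair w 1)).trans hB
  rw [inner_play] at hf ⊢
  set p := inner ℝ (mulVecE (scaling R x)⁻¹ (x - pair w 1)) u
  set q := inner ℝ (pair θ 0) x + inner ℝ (mulVecE (scaling R x) (pair θ 0)) u with hq
  have h2 : |(f (play R x u) - q) * p| ≤ ε * B := by
    rw [abs_mul]
    exact mul_le_mul hf h1 (abs_nonneg _) hε
  have h3 := mul_le_mul_of_nonneg_left (abs_le.1 h2).1 (Nat.cast_nonneg d (α := ℝ))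
  linarith

lemma regret_le_sub_sum_roundError (hd : 1 ≤ d) (hT1 : 1 ≤ T) (hD : 0 < D) (hε : 0 ≤ ε)
    (hδ0 : 0 < δ) (hδ : δ ≤ 1 / 2) (hT : 4 * d ^ 2 * (ν * Real.log (1 / δ)) < T)
    {R : Vec (d + 1) → ℝ} (hR : IsNormalBarrier (con (Metric.closedBall (0 : Vec d) D)) ν R)
    {θ : ℕ → Vec d} {f : ℕ → Vec d → ℝ} {x u : ℕ → Vec (d + 1)} (hθ : ∀ t < T, ‖θ t‖ ≤ G)
    (hf : ∀ t < T, IsApproxLinear (Metric.closedBall (0 : Vec d) D) ε (θ t) (f t))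
    (hf1 : ∀ t < T, ∀ x ∈ Metric.closedBall (0 : Vec d) D, |f t x| ≤ 1)
    (hx : ∀ t < T, x t ∈ lift (shrink δ (Metric.closedBall (0 : Vec d) D)))
    (hmin : ∀ t < T, IsMinOn (fun z => etaParam d T ν δ * ∑ τ ∈ Finset.range t,
      inner ℝ (estimator R (f τ) (x τ) (u τ)) z + R z)
      (lift (shrink δ (Metric.closedBall (0 : Vec d) D))) (x t))
    (hu : ∀ t < T, ‖u t‖ = 1 ∧
      inner ℝ (mulVecE (scaling R (x t)) (EuclideanSpace.single (Fin.last d) 1)) (u t) = 0) :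
    regret (Metric.closedBall (0 : Vec d) D) T f (fun t => play R (x t) (u t)) ≤
      regretBound d T ν G D ε δ - ∑ t ∈ Finset.range T,
        roundError R (θ t) (pair (linearMinimizer D δ (∑ t ∈ Finset.range T, θ t)) 1)
          (x t) (u t) := by
  have hδ1 : δ < 1 := by linarith
  set w := linearMinimizer D δ (∑ t ∈ Finset.range T, θ t) with hw
  have hwS : pair w 1 ∈ lift (shrink δ (Metric.closedBall (0 : Vec d) D)) := by
    rw [mem_lift_shrink_iff hδ1]
    simpa using norm_linearMinimizer_le hD.le hδ1.le _
  have hSi := lift_shrink_subset (d := d) hD hδ0 hδ1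
  have hy : ∀ t < T, ‖play R (x t) (u t)‖ ≤ D := fun t ht =>
    hR.norm_play_le (hSi (hx t ht)) ((mem_lift_shrink_iff hδ1).1 (hx t ht)).2 (hu t ht).1 (hu t ht).2
  obtain ⟨hη, hηd, hηe⟩ := etaParam_spec hd hT1 hR.one_le hδ0 hδ1 hT
  set η := etaParam d T ν δ
  have hg : ∀ t < T, ∀ h, |η * inner ℝ (estimator R (f t) (x t) (u t)) h| ≤
      η * d * localNorm R (x t) h := by
    intro t ht h
    rw [inner_estimator, abs_mul, abs_mul, abs_mul, abs_of_pos hη, Nat.abs_cast]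
    have h1 := hf1 t ht (play R (x t) (u t)) (by simpa using hy t ht)
    have h2 := hR.abs_inner_scaling_inv_le (hSi (hx t ht)) (hu t ht).1 h
    calc _ ≤ η * (d * 1 * localNorm R (x t) h) := by gcongr
      _ = _ := by ring
  have h1 := hR.ftrl_le (convex_lift_shrink hδ1) hSi hηd hT1 hx hmin hg hwS
  have h2 := sub_le_of_mem_lift hD hδ0 hδ hR (hx 0 hT1) hwS
  have h3 : ∑ t ∈ Finset.range T, inner ℝ (estimator R (f t) (x t) (u t)) (x t - pair w 1) ≤
      4 * d * √(ν * T * Real.log (1 / δ)) := by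
    refine le_of_mul_le_mul_left ?_ hη
    rw [← hηe]
    linarith
  have h4 : ∑ t ∈ Finset.range T, inner ℝ (θ t) (play R (x t) (u t) - w) ≤
      ∑ t ∈ Finset.range T, (inner ℝ (estimator R (f t) (x t) (u t)) (x t - pair w 1) +
        d * ε * (2 * (ν + 2 * √ν) * ((1 - δ) / δ)) - roundError R (θ t) (pair w 1) (x t) (u t)) := by
    refine Finset.sum_le_sum fun t ht => ?_
    have ht := Finset.mem_range.1 ht
    refine inner_sub_le_estimator hR (hSi (hx t ht)) (hu t ht).1 hε
      (hf t ht _ (by simpa using hy t ht)) w ?_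
    have e : x t - pair w 1 = (-1 : ℝ) • (pair w 1 - x t) := by module
    rw [e, localNorm_smul]
    simpa using localNorm_sub_le_of_mem_lift hD hδ0 hδ hR (hx t ht) hwS
  rw [Finset.sum_sub_distrib, Finset.sum_add_distrib, Finset.sum_const, Finset.card_range,
    nsmul_eq_mul] at h4
  have h5 := regret_le_linear (G := G) hD.le hδ0.le hθ hf hy
  rw [← hw] at h5
  unfold regretBound
  linarith

end Pathwise

/-! ### The expected regret of a run -/

/-- For `ε = 0` the parameter is `1 / T²` with `T ≥ 2`, hence at most `1/4`. -/
lemma sq_of_half_le_deltaParam {T : ℕ} {ε δ : ℝ} (hT : 1 ≤ T) (hε : 0 ≤ ε)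
    (hδ : δ = deltaParam T ε) (hδ1 : δ < 1) (h : 1 / 2 < δ) : ε = δ ^ 2 := by
  by_cases h0 : ε = 0
  · have e : δ = 1 / (T : ℝ) ^ 2 := by rw [hδ, deltaParam, if_pos h0]
    have hT2 : (2 : ℝ) ≤ T := by
      have : T ≠ 1 := by
        rintro rfl
        rw [e] at hδ1
        norm_num at hδ1
      exact_mod_cast (show 2 ≤ T by omega)
    rw [e, div_lt_div_iff₀ two_pos (by positivity)] at h
    nlinarith
  · rw [hδ, deltaParam, if_neg h0, Real.sq_sqrt hε]

lemma deltaParam_pos {T : ℕ} {ε : ℝ} (hT : 1 ≤ T) (hε : 0 ≤ ε) : 0 < deltaParam T ε := by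
  have hT' : (1 : ℝ) ≤ T := by exact_mod_cast hT
  rw [deltaParam]
  split_ifs with h
  · positivity
  · exact Real.sqrt_pos.2 (lt_of_le_of_ne hε (Ne.symm h))

section Run

variable {Ω : Type*} [mΩ : MeasurableSpace Ω] {P : Measure Ω}
  {d T : ℕ} {ν G D ε δ η : ℝ} {R : Vec (d + 1) → ℝ} {f : ℕ → Ω → Vec d → ℝ}
  {ℱ : Filtration ℕ mΩ} {x' u : ℕ → Ω → Vec (d + 1)}

namespace IsRun

lemma mem_interior (hrun : IsRun P T (Metric.closedBall (0 : Vec d) D) η δ R f ℱ x' u)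
    (hD : 0 < D) (hδ0 : 0 < δ) (hδ1 : δ < 1) {t : ℕ} (ht : t < T) (ω : Ω) :
    x' t ω ∈ interior (con (Metric.closedBall (0 : Vec d) D)) :=
  lift_shrink_subset hD hδ0 hδ1 (hrun.mem t ht ω)

lemma measurable_comp (hrun : IsRun P T (Metric.closedBall (0 : Vec d) D) η δ R f ℱ x' u)
    (hD : 0 < D) (hδ0 : 0 < δ) (hδ1 : δ < 1) {t : ℕ} (ht : t < T)
    {g : Vec (d + 1) → Vec (d + 1)}
    (hg : ContinuousOn g (interior (con (Metric.closedBall (0 : Vec d) D)))) :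
    Measurable[ℱ t] fun ω => g (x' t ω) :=
  measurable_comp_of_continuousOn (m := ℱ t) hg (hrun.measurable_x t ht)
    (hrun.mem_interior hD hδ0 hδ1 ht)

/-- The past is encoded as the identity map into `(Ω, ℱ t)`, so the lemmas on conditional laws given
a variable apply. -/
lemma uniform_comap (hrun : IsRun P T (Metric.closedBall (0 : Vec d) D) η δ R f ℱ x' u)
    {t : ℕ} (ht : t < T) {B : Set (Vec (d + 1))} (hB : MeasurableSet B) :
    P[(u t ⁻¹' B).indicator (fun _ => (1 : ℝ)) | (ℱ t).comap id] =ᵐ[P] fun ω =>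
      (uniformPerp (mulVecE (scaling R (x' t ω))
        (EuclideanSpace.single (Fin.last d) 1))).real B := by
  rw [MeasurableSpace.comap_id]
  exact hrun.uniform t ht B hB

variable [IsProbabilityMeasure P]

lemma ae_unit (hrun : IsRun P T (Metric.closedBall (0 : Vec d) D) η δ R f ℱ x' u)
    (hR : IsNormalBarrier (con (Metric.closedBall (0 : Vec d) D)) ν R) (hd : 1 ≤ d)
    (hD : 0 < D) (hδ0 : 0 < δ) (hδ1 : δ < 1) :
    ∀ᵐ ω ∂P, ∀ t < T, ‖u t ω‖ = 1 ∧
      inner ℝ (mulVecE (scaling R (x' t ω)) (EuclideanSpace.single (Fin.last d) 1))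
        (u t ω) = 0 := by
  refine ae_all_iff.2 fun t => ?_
  by_cases ht : t < T
  · have h := ae_norm_eq_one_of_uniformPerp (P := P) (mβ := ℱ t) (X := (id : Ω → Ω)) hd
      ((@measurable_id Ω (ℱ t)).mono (ℱ.le t) le_rfl)
      ((hrun.measurable_u t ht).mono (ℱ.le _) le_rfl)
      (hrun.measurable_comp hD hδ0 hδ1 ht
        (continuousOn_mulVecE hR.continuousOn_scaling continuousOn_const))
      (fun ω => hR.scaling_single_ne_zero (hrun.mem_interior hD hδ0 hδ1 ht ω) (Fin.last d))
      (fun B hB => hrun.uniform_comap ht hB)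
    filter_upwards [h] with ω hω _
    exact hω
  · exact Eventually.of_forall fun ω h => absurd h ht

/-- The coefficients are continuous on the interior, hence bounded on the compact lifted set, and
known before the draw because `w` is deterministic. -/
lemma integral_roundError (hrun : IsRun P T (Metric.closedBall (0 : Vec d) D) η δ R f ℱ x' u)
    (hR : IsNormalBarrier (con (Metric.closedBall (0 : Vec d) D)) ν R) (hd : 1 ≤ d)
    (hD : 0 < D) (hδ0 : 0 < δ) (hδ1 : δ < 1) {t : ℕ} (ht : t < T) (θ w : Vec d) :
    Integrable (fun ω => roundError R θ (pair w 1) (x' t ω) (u t ω)) P ∧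
      ∫ ω, roundError R θ (pair w 1) (x' t ω) (u t ω) ∂P = 0 := by
  have hA := hR.continuousOn_scaling
  have hca : ContinuousOn (fun x => mulVecE (scaling R x) (pair θ 0))
      (interior (con (Metric.closedBall (0 : Vec d) D))) :=
    continuousOn_mulVecE hA continuousOn_const
  have hcb : ContinuousOn (fun x => mulVecE (scaling R x)⁻¹ (x - pair w 1))
      (interior (con (Metric.closedBall (0 : Vec d) D))) :=
    continuousOn_mulVecE hR.continuousOn_scaling_inv (by fun_prop)
  have hcc : Continuous fun x => inner ℝ (pair θ 0) x := by fun_prop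
  have hK := isCompact_lift_shrink (d := d) (D := D) hδ1
  have hSi := lift_shrink_subset (d := d) hD hδ0 hδ1
  obtain ⟨Ca, hCa⟩ := hK.exists_bound_of_continuousOn (hca.mono hSi)
  obtain ⟨Cb, hCb⟩ := hK.exists_bound_of_continuousOn (hcb.mono hSi)
  obtain ⟨Cc, hCc⟩ := hK.exists_bound_of_continuousOn hcc.continuousOn
  have hmem := fun ω => hrun.mem t ht ω
  have hi := hrun.mem_interior hD hδ0 hδ1 ht
  have h := integral_estimate_eq_zero (P := P) (mβ := ℱ t) (X := (id : Ω → Ω))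
    (v := fun ω => mulVecE (scaling R (x' t ω)) (EuclideanSpace.single (Fin.last d) 1))
    (a := fun ω => mulVecE (scaling R (x' t ω)) (pair θ 0))
    (b := fun ω => mulVecE (scaling R (x' t ω))⁻¹ (x' t ω - pair w 1))
    (c := fun ω => inner ℝ (pair θ 0) (x' t ω)) hd
    ((@measurable_id Ω (ℱ t)).mono (ℱ.le t) le_rfl)
    ((hrun.measurable_u t ht).mono (ℱ.le _) le_rfl)
    (hrun.measurable_comp hD hδ0 hδ1 ht (continuousOn_mulVecE hA continuousOn_const))
    (fun ω => hR.scaling_single_ne_zero (hi ω) (Fin.last d))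
    (fun B hB => hrun.uniform_comap ht hB)
    (hrun.measurable_comp hD hδ0 hδ1 ht hca) (hrun.measurable_comp hD hδ0 hδ1 ht hcb)
    (hcc.measurable.comp (hrun.measurable_x t ht))
    -- `⟨A e_{d+1}, A⁻¹ h⟩` is the last coordinate of `h`, which is `0` for a difference of points
    -- at height `1`.
    (fun ω => by
      rw [inner_mulVecE_comm (scaling_transpose R _), mulVecE_mulVecE, hR.scaling_mul_inv (hi ω),
        mulVecE_one]
      have h := ((mem_lift_shrink_iff hδ1).1 (hmem ω)).2
      simp [EuclideanSpace.inner_single_left, h])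
    (C := max Ca (max Cb Cc))
    (fun ω => (hCa _ (hmem ω)).trans (le_max_left _ _))
    (fun ω => (hCb _ (hmem ω)).trans ((le_max_left _ _).trans (le_max_right _ _)))
    (fun ω => (hCc _ (hmem ω)).trans ((le_max_right _ _).trans (le_max_right _ _)))
  unfold roundError
  exact h

lemma ae_norm_play_le (hrun : IsRun P T (Metric.closedBall (0 : Vec d) D) η δ R f ℱ x' u)
    (hR : IsNormalBarrier (con (Metric.closedBall (0 : Vec d) D)) ν R) (hd : 1 ≤ d)
    (hD : 0 < D) (hδ0 : 0 < δ) (hδ1 : δ < 1) :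
    ∀ᵐ ω ∂P, ∀ t < T, ‖play R (x' t ω) (u t ω)‖ ≤ D := by
  filter_upwards [hrun.ae_unit hR hd hD hδ0 hδ1] with ω hω t ht
  exact hR.norm_play_le (hrun.mem_interior hD hδ0 hδ1 ht ω)
    ((mem_lift_shrink_iff hδ1).1 (hrun.mem t ht ω)).2 (hω t ht).1 (hω t ht).2

lemma ae_abs_regret_le (hrun : IsRun P T (Metric.closedBall (0 : Vec d) D) η δ R f ℱ x' u)
    (hR : IsNormalBarrier (con (Metric.closedBall (0 : Vec d) D)) ν R) (hd : 1 ≤ d)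
    (hD : 0 < D) (hδ0 : 0 < δ) (hδ1 : δ < 1)
    (hf1 : ∀ t < T, ∀ ω, ∀ x ∈ Metric.closedBall (0 : Vec d) D, |f t ω x| ≤ 1) :
    ∀ᵐ ω ∂P, |regret (Metric.closedBall (0 : Vec d) D) T (fun t => f t ω)
      (fun t => play R (x' t ω) (u t ω))| ≤ 2 * T := by
  filter_upwards [hrun.ae_norm_play_le hR hd hD hδ0 hδ1] with ω hω
  have h1 := abs_sum_le_card (T := T) (f := fun t => f t ω (play R (x' t ω) (u t ω)))
    fun t ht => hf1 t ht ω _ (by simpa using hω t ht)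
  have h2 := abs_iInf_sum_le (T := T) (f := fun t => f t ω) hD.le fun t ht => hf1 t ht ω
  refine (abs_sub _ _).trans ?_
  linarith

lemma integrable_regret (hrun : IsRun P T (Metric.closedBall (0 : Vec d) D) η δ R f ℱ x' u)
    (hR : IsNormalBarrier (con (Metric.closedBall (0 : Vec d) D)) ν R) (hd : 1 ≤ d)
    (hD : 0 < D) (hδ0 : 0 < δ) (hδ1 : δ < 1)
    (hf1 : ∀ t < T, ∀ ω, ∀ x ∈ Metric.closedBall (0 : Vec d) D, |f t ω x| ≤ 1)
    (hinf : AEMeasurable (fun ω => ⨅ x : Metric.closedBall (0 : Vec d) D,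
      ∑ t ∈ Finset.range T, f t ω x) P) :
    Integrable (fun ω => regret (Metric.closedBall (0 : Vec d) D) T (fun t => f t ω)
      (fun t => play R (x' t ω) (u t ω))) P := by
  refine Integrable.of_bound ?_ (2 * T) (hrun.ae_abs_regret_le hR hd hD hδ0 hδ1 hf1)
  refine AEMeasurable.aestronglyMeasurable (AEMeasurable.sub ?_ hinf)
  exact (Finset.measurable_fun_sum _ fun t ht =>
    (hrun.measurable_loss t (Finset.mem_range.1 ht)).mono (ℱ.le _) le_rfl).aemeasurable

lemma integral_regret_le (hd : 1 ≤ d) (hT : 1 ≤ T) (hD : 0 < D) (hε : 0 ≤ ε)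
    (hδ : δ = deltaParam T ε) (hδ1 : δ < 1)
    (hrun : IsRun P T (Metric.closedBall (0 : Vec d) D) (etaParam d T ν δ) δ R f ℱ x' u)
    (hR : IsNormalBarrier (con (Metric.closedBall (0 : Vec d) D)) ν R)
    {θ : ℕ → Vec d} (hθ : ∀ t < T, ‖θ t‖ ≤ G)
    (hf : ∀ t < T, ∀ ω, IsApproxLinear (Metric.closedBall (0 : Vec d) D) ε (θ t) (f t ω))
    (hf1 : ∀ t < T, ∀ ω, ∀ x ∈ Metric.closedBall (0 : Vec d) D, |f t ω x| ≤ 1)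
    (hinf : AEMeasurable (fun ω => ⨅ x : Metric.closedBall (0 : Vec d) D,
      ∑ t ∈ Finset.range T, f t ω x) P) :
    ∫ ω, regret (Metric.closedBall (0 : Vec d) D) T (fun t => f t ω)
      (fun t => play R (x' t ω) (u t ω)) ∂P ≤ regretBound d T ν G D ε δ := by
  have hδ0 : 0 < δ := hδ ▸ deltaParam_pos hT hε
  have hν := hR.one_le
  have hG : 0 ≤ G := (norm_nonneg _).trans (hθ 0 hT)
  have hint := hrun.integrable_regret hR hd hD hδ0 hδ1 hf1 hinf
  -- Covers the regimes `δ > 1/2` and small `T`, where the barrier estimates are not available.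
  have htriv : 2 * T ≤ regretBound d T ν G D ε δ →
      ∫ ω, regret (Metric.closedBall (0 : Vec d) D) T (fun t => f t ω)
        (fun t => play R (x' t ω) (u t ω)) ∂P ≤ regretBound d T ν G D ε δ := by
    intro h
    refine (integral_mono_ae hint (integrable_const (2 * T : ℝ)) ?_).trans (by simpa using h)
    filter_upwards [hrun.ae_abs_regret_le hR hd hD hδ0 hδ1 hf1] with ω hω
    exact (abs_le.1 hω).2
  rcases lt_or_ge (1 / 2) δ with h | hδh
  · exact htriv (two_mul_le_regretBound_of_half_le hd hν hG hD.le h.le hδ1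
      (sq_of_half_le_deltaParam hT hε hδ hδ1 h))
  rcases le_or_gt (T : ℝ) (4 * d ^ 2 * (ν * Real.log (1 / δ))) with h | hTL
  · exact htriv (two_mul_le_regretBound_of_le hd hν hG hD.le hε hδ0 hδ1 h)
  set w := linearMinimizer D δ (∑ t ∈ Finset.range T, θ t)
  have herr := fun t (ht : t < T) => hrun.integral_roundError hR hd hD hδ0 hδ1 ht (θ t) w
  have hsum : Integrable (fun ω => ∑ t ∈ Finset.range T,
      roundError R (θ t) (pair w 1) (x' t ω) (u t ω)) P :=
    integrable_finsetSum _ fun t ht => (herr t (Finset.mem_range.1 ht)).1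
  have hle := integral_mono_ae hint
    ((integrable_const (regretBound d T ν G D ε δ)).sub hsum) (by
      filter_upwards [hrun.ae_unit hR hd hD hδ0 hδ1] with ω hω
      exact regret_le_sub_sum_roundError hd hT hD hε hδ0 hδh hTL hR hθ
        (fun t ht => hf t ht ω) (fun t ht => hf1 t ht ω) (fun t ht => hrun.mem t ht ω)
        (fun t ht => hrun.isMinOn t ht ω) hω)
  refine hle.trans (le_of_eq ?_)
  have e := integral_sub (integrable_const (μ := P) (regretBound d T ν G D ε δ)) hsum
  refine e.trans ?_
  rw [integral_finsetSum _ fun t ht => (herr t (Finset.mem_range.1 ht)).1,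
    Finset.sum_eq_zero fun t ht => (herr t (Finset.mem_range.1 ht)).2]
  simp

end IsRun

end Run

end BanditLifting

end

theorem theorem1 (ν G D : ℝ) (hD : 1 ≤ D) :
    -- the bound on the expected regret
    (∀ (d T : ℕ) (ε δ η : ℝ), 1 ≤ d → 1 ≤ T → 0 ≤ ε →
      δ = BanditLifting.deltaParam T ε → δ < 1 → η = BanditLifting.etaParam d T ν δ →
      ∀ (K : Set (BanditLifting.Vec d)), K = Metric.closedBall 0 D →
      ∀ (R : BanditLifting.Vec (d + 1) → ℝ),
        BanditLifting.IsNormalBarrier (BanditLifting.con K) ν R →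
      ∀ (Ω : Type*) [mΩ : MeasurableSpace Ω] (P : Measure Ω) [IsProbabilityMeasure P]
        (θ : ℕ → BanditLifting.Vec d) (f : ℕ → Ω → BanditLifting.Vec d → ℝ)
        (ℱ : Filtration ℕ mΩ) (x' u : ℕ → Ω → BanditLifting.Vec (d + 1)),
        (∀ t < T, ‖θ t‖ ≤ G) →
        (∀ t < T, ∀ ω, BanditLifting.IsApproxLinear K ε (θ t) (f t ω)) →
        (∀ t < T, ∀ ω, ∀ x ∈ K, |f t ω x| ≤ 1) →
        AEMeasurable (fun ω => ⨅ x : K, ∑ t ∈ Finset.range T, f t ω x) P →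
        BanditLifting.IsRun P T K η δ R f ℱ x' u →
        Integrable (fun ω => BanditLifting.regret K T (fun t => f t ω)
          (fun t => BanditLifting.play R (x' t ω) (u t ω))) P ∧
        ∫ ω, BanditLifting.regret K T (fun t => f t ω)
          (fun t => BanditLifting.play R (x' t ω) (u t ω)) ∂P
          ≤ BanditLifting.regretBound d T ν G D ε δ) ∧
    -- the order of this bound, up to the logarithmic factor `√(ln (1 / δ))`
    (∃ C : ℝ, ∀ (d T : ℕ) (ε δ : ℝ), 1 ≤ d → 1 ≤ T → 0 ≤ ε →
      δ = BanditLifting.deltaParam T ε → δ < 1 →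
      BanditLifting.regretBound d T ν G D ε δ
        ≤ C * (√(Real.log (1 / δ)) * (d * √T) + √ε * d * T + ε * d * T)) := by
  refine ⟨?_, BanditLifting.regretBound_order ν G D⟩
  rintro d T ε δ η hd hT hε hδ hδ1 rfl K rfl R hR Ω mΩ P hP θ f ℱ x' u hθ hf hf1 hinf hrun
  have hD0 : 0 < D := by linarith
  exact ⟨hrun.integrable_regret hR hd hD0 (hδ ▸ BanditLifting.deltaParam_pos hT hε) hδ1 hf1 hinf,
    BanditLifting.IsRun.integral_regret_le hd hT hD0 hε hδ hδ1 hrun hR hθ hf hf1 hinf⟩
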